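/- Let $m>2$ and equip $\mathbb C^m$ with the metric $g'=\sum_j|dz_j|^2$, the Kähler form $\omega'=\frac i2\sum_j dz_j\wedge d\bar z_j$ and the complex volume form $\Omega'=dz_1\wedge\cdots\wedge dz_m$. A special Lagrangian (SL) $m$-fold in $\mathbb C^m$ is an embedded real $m$-dimensional submanifold which has an orientation for which it is calibrated with respect to $\operatorname{Re}\Omega'$, that is, for which $\operatorname{Re}\Omega'$ restricts to the Riemannian volume form on each tangent space. Let $C\subset\mathbb C^m$ be a closed SL cone with an isolated singularity at $0$: $C$ is closed, $tC=C$ for all $t>0$, $C'=C\setminus\{0\}$ is a nonempty SL $m$-fold, and $0$ is a singular point of $C$ (that is, $C$ is not an embedded $m$-dimensional submanifold near $0$). Let $\Sigma=C\cap S^{2m-1}$ and give $C'$ and $\Sigma$ the metrics induced by $g'$. A function $u:C'\to\mathbb R$ is homogeneous of order $\alpha$ if $u(tx)=t^\alpha u(x)$ for all $t>0$ and $x\in C'$. For $\alpha\in\mathbb R$ let $m_\Sigma(\alpha)$ be the multiplicity of $\alpha(\alpha+m-2)$ as an eigenvalue of the (nonnegative) Laplacian $\Delta_\Sigma=d^*d$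 on functions on $\Sigma$. Let $G$ be the Lie subgroup of $\mathrm{SU}(m)$ preserving $C$. An $\mathfrak{su}(m)$ moment map is a differentiable function $\mu:\mathbb C^m\to\mathbb R$ such that $d\mu=v\cdot\omega'$, where $v$ is the vector field $x\mapsto Ax$ for some $A\in\mathfrak{su}(m)$ (a traceless skew-Hermitian matrix) and $v\cdot\omega'=\omega'(v,\,\cdot\,)$. Then: (a) The restrictions to $C'$ of the real linear functions on $\mathbb C^m$ form a vector space of order $1$ homogeneous harmonic functions on $C'$, of dimension $2m$. Hence $m_\Sigma(1)\ge 2m$. (b) The restrictions to $C'$ of the $\mathfrak{su}(m)$ moment maps $\mu:\mathbb C^m\to\mathbb R$ with $\mu(0)=0$ form a vector space of order $2$ homogeneous harmonic functions on $C'$, of dimension $m^2-1-\dim G$. Hence $m_\Sigma(2)\ge m^2-1-\dim G$. -/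

import Mathlib

open scoped ContDiff InnerProductSpace

noncomputable section

namespace SLCone

/-! ### Embedded submanifolds of a Euclidean space and their Laplacians -/

section Submanifold

variable {E : Type*} [NormedAddCommGroup E] [InnerProductSpace ℝ E]

/-- The partial derivative of `f` with respect to the `i`-th coordinate at `y`. -/
def pderiv {F : Type*} [NormedAddCommGroup F] [NormedSpace ℝ F] {k : ℕ}
    (f : EuclideanSpace ℝ (Fin k) → F) (i : Fin k) (y : EuclideanSpace ℝ (Fin k)) : F :=
  fderiv ℝ f y (EuclideanSpace.single i 1)

/-- `φ`, on the open set `V` of `ℝᵏ`, is a smooth local parametrization (inverse of a chart) of the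
`k`-dimensional embedded submanifold `L` of `E`: it is a smooth immersion, a homeomorphism onto its
image, and its image is a relatively open subset of `L`. -/
structure IsLocalParam (L : Set E) (k : ℕ) (φ : EuclideanSpace ℝ (Fin k) → E)
    (V : Set (EuclideanSpace ℝ (Fin k))) : Prop where
  isOpen : IsOpen V
  contDiffOn : ContDiffOn ℝ ∞ φ V
  injective_fderiv : ∀ y ∈ V, Function.Injective (fderiv ℝ φ y)
  isEmbedding : Topology.IsEmbedding (V.domRestrict φ)
  image_open : ∃ U : Set E, IsOpen U ∧ φ '' V = L ∩ U

/-- The induced Riemannian metric `g_{ij} = ⟨∂_i φ, ∂_j φ⟩` in a local parametrization. -/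
def metric {k : ℕ} (φ : EuclideanSpace ℝ (Fin k) → E) (y : EuclideanSpace ℝ (Fin k)) :
    Matrix (Fin k) (Fin k) ℝ :=
  Matrix.gram ℝ fun i => pderiv φ i y

/-- The density `√(det g)` of the Riemannian volume form in a local parametrization. -/
def volDensity {k : ℕ} (φ : EuclideanSpace ℝ (Fin k) → E) (y : EuclideanSpace ℝ (Fin k)) : ℝ :=
  √(metric φ y).det

/-- The components `√(det g) ∑_j g^{ij} ∂_j f` of the gradient of `f`, times the volume density. -/
def gradFlux {k : ℕ} (φ : EuclideanSpace ℝ (Fin k) → E) (f : EuclideanSpace ℝ (Fin k) → ℝ)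
    (i : Fin k) (y : EuclideanSpace ℝ (Fin k)) : ℝ :=
  volDensity φ y * ∑ j, (metric φ y)⁻¹ i j * pderiv f j y

/-- The Laplacian `Δ = d*d` (with nonnegative spectrum) of the induced metric, in local coordinates:
`Δ f = -(det g)^{-1/2} ∑_i ∂_i ((det g)^{1/2} ∑_j g^{ij} ∂_j f)`. -/
def chartLaplacian {k : ℕ} (φ : EuclideanSpace ℝ (Fin k) → E) (f : EuclideanSpace ℝ (Fin k) → ℝ)
    (y : EuclideanSpace ℝ (Fin k)) : ℝ :=
  -((volDensity φ y)⁻¹ * ∑ i, pderiv (gradFlux φ f i) i y)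

/-- The coordinate expression `u ∘ φ` of a function `u` on `L` (with value `0` at points that `φ`
does not map into `L`). -/
def pullback {L : Set E} {k : ℕ} (u : L → ℝ) (φ : EuclideanSpace ℝ (Fin k) → E) :
    EuclideanSpace ℝ (Fin k) → ℝ :=
  fun y => Function.extend Subtype.val u 0 (φ y)

/-- `u` is a smooth function on the `k`-dimensional submanifold `L`. -/
def IsSmooth (L : Set E) (k : ℕ) (u : L → ℝ) : Prop :=
  ∀ φ V, IsLocalParam L k φ V → ContDiffOn ℝ ∞ (pullback u φ) V

/-- `Δ u = w` on the `k`-dimensional submanifold `L`, where `Δ` is the Laplacian of the induced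
metric. -/
def HasLaplacian (L : Set E) (k : ℕ) (u w : L → ℝ) : Prop :=
  ∀ φ V, IsLocalParam L k φ V → ∀ y ∈ V, chartLaplacian φ (pullback u φ) y = pullback w φ y

/-- `u` is a (smooth) harmonic function on the `k`-dimensional submanifold `L`. -/
def IsHarmonic (L : Set E) (k : ℕ) (u : L → ℝ) : Prop :=
  IsSmooth L k u ∧ HasLaplacian L k u 0

/-- `u` is homogeneous of order `α`: `u (t x) = t ^ α u x` for `t > 0`. -/
def IsHomogeneous {L : Set E} (α : ℝ) (u : L → ℝ) : Prop :=
  ∀ (x y : L) (t : ℝ), 0 < t → (y : E) = t • (x : E) → u y = t ^ α * u x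

set_option linter.unusedSectionVars false in
lemma pullback_add {L : Set E} {k : ℕ} (u v : L → ℝ) (φ : EuclideanSpace ℝ (Fin k) → E) :
    pullback (u + v) φ = pullback u φ + pullback v φ := by
  funext y
  by_cases h : φ y ∈ L
  · have e : ∀ w : L → ℝ, Function.extend Subtype.val w 0 (φ y) = w ⟨φ y, h⟩ := fun w =>
      Subtype.val_injective.extend_apply w 0 ⟨φ y, h⟩
    simp [pullback, e]
  · have e : ∀ w : L → ℝ, Function.extend Subtype.val w 0 (φ y) = 0 := fun w =>
      by
      refine Function.extend_apply' w (0 : E → ℝ) (φ y) ?_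
      rintro ⟨a, ha⟩
      exact h (ha ▸ a.2)
    simp [pullback, e]

set_option linter.unusedSectionVars false in
lemma pullback_smul {L : Set E} {k : ℕ} (c : ℝ) (u : L → ℝ) (φ : EuclideanSpace ℝ (Fin k) → E) :
    pullback (c • u) φ = c • pullback u φ := by
  funext y
  by_cases h : φ y ∈ L
  · have e : ∀ w : L → ℝ, Function.extend Subtype.val w 0 (φ y) = w ⟨φ y, h⟩ := fun w =>
      Subtype.val_injective.extend_apply w 0 ⟨φ y, h⟩
    simp [pullback, e]
  · have e : ∀ w : L → ℝ, Function.extend Subtype.val w 0 (φ y) = 0 := fun w =>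
      by
      refine Function.extend_apply' w (0 : E → ℝ) (φ y) ?_
      rintro ⟨a, ha⟩
      exact h (ha ▸ a.2)
    simp [pullback, e]

lemma pullback_zero {L : Set E} {k : ℕ} (φ : EuclideanSpace ℝ (Fin k) → E) :
    pullback (0 : L → ℝ) φ = 0 := by
  simpa using pullback_smul 0 (0 : L → ℝ) φ

lemma contDiffOn_pderiv {F : Type*} [NormedAddCommGroup F] [NormedSpace ℝ F] {k : ℕ}
    {f : EuclideanSpace ℝ (Fin k) → F} {V : Set (EuclideanSpace ℝ (Fin k))} (hV : IsOpen V)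
    (hf : ContDiffOn ℝ ∞ f V) (i : Fin k) : ContDiffOn ℝ ∞ (pderiv f i) V :=
  (hf.fderiv_of_isOpen hV (m := ∞) (by simp)).clm_apply contDiffOn_const

lemma contDiffOn_det {ι X : Type*} [Fintype ι] [DecidableEq ι] [NormedAddCommGroup X]
    [NormedSpace ℝ X] {V : Set X} {A : X → Matrix ι ι ℝ}
    (hA : ∀ i j, ContDiffOn ℝ ∞ (fun y => A y i j) V) :
    ContDiffOn ℝ ∞ (fun y => (A y).det) V := by
  simp only [Matrix.det_apply']
  exact ContDiffOn.sum fun σ _ => contDiffOn_const.mul (contDiffOn_prod fun i _ => hA _ _)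

lemma IsLocalParam.det_metric_pos {L : Set E} {k : ℕ} {φ : EuclideanSpace ℝ (Fin k) → E}
    {V : Set (EuclideanSpace ℝ (Fin k))} (h : IsLocalParam L k φ V)
    {y : EuclideanSpace ℝ (Fin k)} (hy : y ∈ V) : 0 < (metric φ y).det := by
  refine (Matrix.posDef_gram_of_linearIndependent ?_).det_pos
  have h1 : LinearIndependent ℝ fun i : Fin k => (EuclideanSpace.single i (1 : ℝ)) := by
    have h2 := (EuclideanSpace.basisFun (Fin k) ℝ).toBasis.linearIndependent
    have h3 : ⇑(EuclideanSpace.basisFun (Fin k) ℝ).toBasis =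
        fun i : Fin k => (EuclideanSpace.single i (1 : ℝ)) := by
      funext i
      simp
    rwa [h3] at h2
  exact h1.map' (fderiv ℝ φ y : EuclideanSpace ℝ (Fin k) →ₗ[ℝ] E)
    (LinearMap.ker_eq_bot.2 (h.injective_fderiv y hy))

lemma IsLocalParam.contDiffOn_metric {L : Set E} {k : ℕ} {φ : EuclideanSpace ℝ (Fin k) → E}
    {V : Set (EuclideanSpace ℝ (Fin k))} (h : IsLocalParam L k φ V) (i j : Fin k) :
    ContDiffOn ℝ ∞ (fun y => metric φ y i j) V :=
  (contDiffOn_pderiv h.isOpen h.contDiffOn i).inner ℝ (contDiffOn_pderiv h.isOpen h.contDiffOn j)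

lemma IsLocalParam.contDiffOn_volDensity {L : Set E} {k : ℕ} {φ : EuclideanSpace ℝ (Fin k) → E}
    {V : Set (EuclideanSpace ℝ (Fin k))} (h : IsLocalParam L k φ V) :
    ContDiffOn ℝ ∞ (volDensity φ) V :=
  (contDiffOn_det h.contDiffOn_metric).sqrt fun _ hy => (h.det_metric_pos hy).ne'

lemma IsLocalParam.contDiffOn_inv_metric {L : Set E} {k : ℕ} {φ : EuclideanSpace ℝ (Fin k) → E}
    {V : Set (EuclideanSpace ℝ (Fin k))} (h : IsLocalParam L k φ V) (i j : Fin k) :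
    ContDiffOn ℝ ∞ (fun y => (metric φ y)⁻¹ i j) V := by
  have h1 : ContDiffOn ℝ ∞ (fun y => ((metric φ y).det)⁻¹) V :=
    (contDiffOn_det h.contDiffOn_metric).inv fun _ hy => (h.det_metric_pos hy).ne'
  have h2 : ContDiffOn ℝ ∞ (fun y => (metric φ y).adjugate i j) V := by
    simp only [Matrix.adjugate_apply]
    refine contDiffOn_det fun a b => ?_
    by_cases hab : a = j
    · subst hab
      simpa using contDiffOn_const
    · simpa [Matrix.updateRow_ne hab] using h.contDiffOn_metric a b
  refine (h1.mul h2).congr fun y _ => ?_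
  simp [Matrix.inv_def]

lemma IsLocalParam.contDiffOn_gradFlux {L : Set E} {k : ℕ} {φ : EuclideanSpace ℝ (Fin k) → E}
    {V : Set (EuclideanSpace ℝ (Fin k))} (h : IsLocalParam L k φ V)
    {f : EuclideanSpace ℝ (Fin k) → ℝ} (hf : ContDiffOn ℝ ∞ f V) (i : Fin k) :
    ContDiffOn ℝ ∞ (gradFlux φ f i) V :=
  h.contDiffOn_volDensity.mul
    (ContDiffOn.sum fun j _ => (h.contDiffOn_inv_metric i j).mul (contDiffOn_pderiv h.isOpen hf j))

lemma IsLocalParam.chartLaplacian_add {L : Set E} {k : ℕ} {φ : EuclideanSpace ℝ (Fin k) → E}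
    {V : Set (EuclideanSpace ℝ (Fin k))} (h : IsLocalParam L k φ V)
    {f f' : EuclideanSpace ℝ (Fin k) → ℝ} (hf : ContDiffOn ℝ ∞ f V) (hf' : ContDiffOn ℝ ∞ f' V)
    {y : EuclideanSpace ℝ (Fin k)} (hy : y ∈ V) :
    chartLaplacian φ (f + f') y = chartLaplacian φ f y + chartLaplacian φ f' y := by
  have hd : ∀ {a : EuclideanSpace ℝ (Fin k) → ℝ}, ContDiffOn ℝ ∞ a V → ∀ z ∈ V,
      DifferentiableAt ℝ a z := fun ha z hz =>
    (ha.contDiffAt (h.isOpen.mem_nhds hz)).differentiableAt (by simp)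
  have h1 : ∀ i, pderiv (gradFlux φ (f + f') i) i y
      = pderiv (gradFlux φ f i) i y + pderiv (gradFlux φ f' i) i y := by
    intro i
    have e : gradFlux φ (f + f') i =ᶠ[nhds y] gradFlux φ f i + gradFlux φ f' i := by
      filter_upwards [h.isOpen.mem_nhds hy] with z hz
      simp [gradFlux, pderiv, fderiv_add (hd hf z hz) (hd hf' z hz), mul_add,
        Finset.sum_add_distrib]
    simp [pderiv, e.fderiv_eq, fderiv_add (hd (h.contDiffOn_gradFlux hf i) y hy)
      (hd (h.contDiffOn_gradFlux hf' i) y hy)]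
  simp only [chartLaplacian, h1, Finset.sum_add_distrib]
  ring

lemma chartLaplacian_smul {k : ℕ} (φ : EuclideanSpace ℝ (Fin k) → E) (c : ℝ)
    (f : EuclideanSpace ℝ (Fin k) → ℝ) (y : EuclideanSpace ℝ (Fin k)) :
    chartLaplacian φ (c • f) y = c * chartLaplacian φ f y := by
  have h1 : ∀ i, gradFlux φ (c • f) i = c • gradFlux φ f i := by
    intro i
    funext z
    simp only [gradFlux, pderiv, fderiv_const_smul_field, smul_apply,
      Pi.smul_apply, smul_eq_mul, Finset.mul_sum]
    exact Finset.sum_congr rfl fun j _ => by ring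
  simp only [chartLaplacian, h1, pderiv, fderiv_const_smul_field, smul_apply,
    smul_eq_mul, Finset.mul_sum, mul_neg, Pi.smul_apply]
  rw [neg_inj]
  exact Finset.sum_congr rfl fun j _ => by ring

/-- The space of smooth functions `u` on the `k`-dimensional submanifold `L` with `Δ u = lam u`:
the eigenspace of the Laplacian for `lam`. -/
def eigenspace (L : Set E) (k : ℕ) (lam : ℝ) : Submodule ℝ (L → ℝ) where
  carrier := {u | IsSmooth L k u ∧ HasLaplacian L k u (lam • u)}
  zero_mem' := by
    constructor
    · intro φ V _
      rw [pullback_zero]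
      exact contDiffOn_const
    · intro φ V _ y _
      have := chartLaplacian_smul φ 0 0 y
      simp only [smul_zero, zero_mul] at this
      rw [smul_zero, pullback_zero, this]
      rfl
  add_mem' := by
    rintro u v ⟨hu, hu'⟩ ⟨hv, hv'⟩
    constructor
    · intro φ V h
      rw [pullback_add]
      exact (hu φ V h).add (hv φ V h)
    · intro φ V h y hy
      rw [smul_add, pullback_add, pullback_add, h.chartLaplacian_add (hu φ V h) (hv φ V h) hy,
        hu' φ V h y hy, hv' φ V h y hy]
      rfl
  smul_mem' := by
    rintro c u ⟨hu, hu'⟩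
    constructor
    · intro φ V h
      rw [pullback_smul]
      exact (hu φ V h).const_smul c
    · intro φ V h y hy
      rw [smul_comm, pullback_smul, pullback_smul, chartLaplacian_smul, hu' φ V h y hy]
      rfl

end Submanifold

/-! ### Special Lagrangian cones in `ℂᵐ` -/

/-- `ℂᵐ` with its Hermitian metric; its real inner product is the metric `∑ |dz_j|²`. -/
abbrev Cn (m : ℕ) : Type := EuclideanSpace ℂ (Fin m)

/-- The Kähler form `(i/2) ∑ dz_j ∧ dz̄_j` of `ℂᵐ`, i.e. `∑ dx_j ∧ dy_j`. -/
def kahlerForm {m : ℕ} (v w : Cn m) : ℝ :=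
  ∑ j, ((v j).re * (w j).im - (v j).im * (w j).re)

/-- The complex volume form `dz_1 ∧ ⋯ ∧ dz_m` of `ℂᵐ`. -/
def holVolForm {m : ℕ} (v : Fin m → Cn m) : ℂ :=
  Matrix.det (Matrix.of fun i j => v j i)

/-- `L` is a special Lagrangian `m`-fold in `ℂᵐ`: an embedded `m`-dimensional submanifold with an
orientation for which it is calibrated with respect to `Re (dz_1 ∧ ⋯ ∧ dz_m)`. The orientation is
given by the parametrizations in which the calibration form equals the volume form `√(det g) dy` of
the induced metric; two of these differ by a change of coordinates with positive Jacobian. -/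
def IsSpecialLagrangian {m : ℕ} (L : Set (Cn m)) : Prop :=
  ∀ x ∈ L, ∃ φ V, IsLocalParam L m φ V ∧ x ∈ φ '' V ∧
    ∀ y ∈ V, (holVolForm fun i => pderiv φ i y).re = volDensity φ y

/-- `C` is a closed special Lagrangian cone in `ℂᵐ` with an isolated singularity at `0`: it is a
closed cone, `C ∖ {0}` is a (nonempty) special Lagrangian `m`-fold, and `0` is a singular point,
that is, `C` is not an embedded `m`-dimensional submanifold near `0`. -/
structure IsSLCone {m : ℕ} (C : Set (Cn m)) : Prop where
  isClosed : IsClosed C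
  cone : ∀ t : ℝ, 0 < t → (fun x => t • x) '' C = C
  nonempty : (C \ {0}).Nonempty
  specialLagrangian : IsSpecialLagrangian (C \ {0})
  singular : ¬ ∃ φ V, IsLocalParam C m φ V ∧ 0 ∈ φ '' V

/-- The link `Σ = C ∩ S^{2m-1}` of a cone. -/
def link {m : ℕ} (C : Set (Cn m)) : Set (Cn m) := C ∩ Metric.sphere 0 1

/-- `m_Σ(α)` for `Σ = C ∩ S^{2m-1}`: the multiplicity of `α (α + m - 2)` as an eigenvalue of the
Laplacian of the `(m-1)`-dimensional Riemannian manifold `Σ`. -/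
def multiplicity {m : ℕ} (C : Set (Cn m)) (α : ℝ) : Cardinal :=
  Module.rank ℝ (eigenspace (link C) (m - 1) (α * (α + m - 2)))

/-! ### The stabilizer of a cone and moment maps -/

/-- The subgroup of `SU(m)` preserving `C`. -/
def stabilizerSU {m : ℕ} (C : Set (Cn m)) :
    Subgroup (Matrix.specialUnitaryGroup (Fin m) ℂ) where
  carrier := {g | Matrix.toEuclideanLin (g : Matrix (Fin m) (Fin m) ℂ) '' C = C}
  one_mem' := by simp [Matrix.toEuclideanLin]
  mul_mem' := by
    intro a b ha hb
    simp only [Set.mem_ofPred_eq] at ha hb ⊢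
    conv_rhs => rw [← ha, ← hb, Set.image_image]
    refine Set.image_congr fun x _ => ?_
    simp [Matrix.toLpLin_apply]
  inv_mem' := by
    intro a ha
    simp only [Set.mem_ofPred_eq] at ha ⊢
    have key : ((a⁻¹ : Matrix.specialUnitaryGroup (Fin m) ℂ) : Matrix (Fin m) (Fin m) ℂ) *
        (a : Matrix (Fin m) (Fin m) ℂ) = 1 :=
      congrArg Subtype.val (inv_mul_cancel a)
    conv_lhs => rw [← ha, Set.image_image]
    conv_rhs => rw [← Set.image_id C]
    refine Set.image_congr fun x _ => ?_
    simp [Matrix.toLpLin_apply, key]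

/-- The Lie algebra of a (closed) subgroup `G` of `SU(m)`: its tangent space at the identity, the
space of the velocities `γ'(0)` of smooth curves `γ` in `G` with `γ(0) = 1`. -/
def lieAlgebra {m : ℕ} (G : Subgroup (Matrix.specialUnitaryGroup (Fin m) ℂ)) :
    Submodule ℝ (Matrix (Fin m) (Fin m) ℂ) where
  carrier := {A | ∃ γ : ℝ → Matrix.specialUnitaryGroup (Fin m) ℂ, (∀ t, γ t ∈ G) ∧ γ 0 = 1 ∧
    (∀ i j, ContDiff ℝ ∞ fun t => (γ t : Matrix (Fin m) (Fin m) ℂ) i j) ∧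
    ∀ i j, HasDerivAt (fun t => (γ t : Matrix (Fin m) (Fin m) ℂ) i j) (A i j) 0}
  zero_mem' := ⟨fun _ => 1, fun _ => G.one_mem, rfl, fun _ _ => contDiff_const,
    fun _ _ => hasDerivAt_const _ _⟩
  add_mem' := by
    rintro A B ⟨a, ha, ha0, has, haA⟩ ⟨b, hb, hb0, hbs, hbB⟩
    refine ⟨fun t => a t * b t, fun t => G.mul_mem (ha t) (hb t), by simp [ha0, hb0], ?_, ?_⟩
    · intro i j
      simp only [Submonoid.coe_mul, Matrix.mul_apply]
      exact ContDiff.sum fun l _ => (has i l).mul (hbs l j)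
    · intro i j
      simp only [Submonoid.coe_mul, Matrix.mul_apply]
      have := HasDerivAt.fun_sum (u := Finset.univ) fun l _ => (haA i l).mul (hbB l j)
      refine this.congr_deriv ?_
      simp [ha0, hb0, Matrix.one_apply, Finset.sum_add_distrib]
  smul_mem' := by
    rintro c A ⟨a, ha, ha0, has, haA⟩
    refine ⟨fun t => a (c * t), fun t => ha _, by simp [ha0], ?_, ?_⟩
    · intro i j
      exact (has i j).comp (contDiff_const.mul contDiff_id)
    · intro i j
      have h1 : HasDerivAt (fun t : ℝ => c * t) c 0 := by
        simpa using (hasDerivAt_id (0 : ℝ)).const_mul c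
      have h2 : HasDerivAt (fun t => (a t : Matrix (Fin m) (Fin m) ℂ) i j) (A i j) (c * 0) := by
        simpa using haA i j
      exact (h2.scomp (0 : ℝ) h1).congr_deriv (by simp)

/-- The dimension of a (closed, hence Lie) subgroup of `SU(m)`. -/
def lieDim {m : ℕ} (G : Subgroup (Matrix.specialUnitaryGroup (Fin m) ℂ)) : ℕ :=
  Module.finrank ℝ (lieAlgebra G)

/-- `μ` is a moment map for the vector field `v` on `ℂᵐ`: `v ⌟ ω = dμ`. -/
def IsMomentMap {m : ℕ} (v : Cn m → Cn m) (μ : Cn m → ℝ) : Prop :=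
  Differentiable ℝ μ ∧ ∀ x w, fderiv ℝ μ x w = kahlerForm (v x) w

/-- `μ` is an `su(m)` moment map: a moment map for the linear vector field `x ↦ A x` of a traceless
skew-Hermitian matrix `A`. -/
def IsSuMomentMap {m : ℕ} (μ : Cn m → ℝ) : Prop :=
  ∃ A : Matrix (Fin m) (Fin m) ℂ, A.conjTranspose = -A ∧ A.trace = 0 ∧
    IsMomentMap (fun x => Matrix.toEuclideanLin A x) μ

end SLCone

end

/-! Everything rests on one computation. Call a function `u` on `ℂᵐ` admissible if its gradient is a
complex affine field `X(x) = B x + w` with `trace B = 0`. Real linear functions are admissible with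
`B = 0`. The moment map of `A ∈ su(m)` vanishing at 0 is `½⟨iAx, x⟩`, which is admissible with `B =
iA`, because `iA` is Hermitian.

A special Lagrangian tangent frame `v` has real Hermitian Gram matrix and real `Ω(v) = ±√(det g)`
(`IsCalibratedFrame.gram_eq`, `IsCalibratedFrame.im_eq_zero`). By Cramer's rule, the flux component
`√(det g) (grad u)^i` is therefore, up to a locally constant sign, the real part of `Ω(v)` with
`v_i` replaced by `X`. In its divergence the terms containing second derivatives of the
parametrization cancel, since these are symmetric and `Ω` is alternating; the rest adds up to `trace
B · Ω(v) = 0`. So `u` is harmonic on the cone (`IsSpecialLagrangian.isHarmonic`). The same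
computation on the link, with the position vector added to the frame, gives `Δ u = (m-1)⟨x, X⟩ + ⟨x,
Bx⟩` (`IsSLCone.chartLaplacian_link`), from which the eigenvalues `m-1` and `2m` can be read off.
Homogeneous functions are determined on the link, so the multiplicity bounds follow from the
dimensions.

For the dimensions, suppose an admissible `u` vanishes on the cone. Then its gradient is normal, and
since the cone is Lagrangian, `-iX` is tangent. If `u = ⟨w, ·⟩`, the constant field `-iw` is
tangent, so the closed cone is invariant under translations along it; for `w ≠ 0` a chart at a
nonzero point could be translated to the vertex, which is singular (`IsSLCone.linear_eq_zero`). If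
`u` is the moment map of `A`, the field `Ax` is tangent, so `exp(tA)` preserves the cone and `A`
lies in the Lie algebra of `G`. Conversely, for such `A` both `Ax` and `x` are tangent, whence
`ω(Ax, x) = 0`. The kernel of restriction is thus exactly that Lie algebra
(`IsSLCone.map_ker_momentRestrict`), and rank-nullity finishes. -/

noncomputable section

namespace SLCone

/-! ### Linear algebra of special Lagrangian frames -/

section LinearAlgebra

open Matrix
open scoped ComplexOrder

/-- Equality case of the arithmetic-geometric mean inequality for eigenvalues. -/
lemma eq_one_of_posSemidef {m : ℕ} {H : Matrix (Fin m) (Fin m) ℂ} (hH : H.PosSemidef)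
    (htr : H.trace = m) (hdet : 1 ≤ H.det.re) : H = 1 := by
  have hh := hH.isHermitian
  have hsum : ∑ i, hh.eigenvalues i = m := by
    have h := hh.trace_eq_sum_eigenvalues
    rw [htr] at h
    have h' := congrArg Complex.re h
    simpa using h'.symm
  have hprod : 1 ≤ ∏ i, hh.eigenvalues i := by
    have h := hh.det_eq_prod_eigenvalues
    rw [h] at hdet
    have e : (∏ i, (hh.eigenvalues i : ℂ)).re = ∏ i, hh.eigenvalues i := by
      rw [← Complex.ofReal_prod, Complex.ofReal_re]
    exact e ▸ hdet
  have hpos : ∀ i, 0 < hh.eigenvalues i := fun i => by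
    refine lt_of_le_of_ne (hH.eigenvalues_nonneg i) fun h => ?_
    rw [Finset.prod_eq_zero (Finset.mem_univ i) h.symm] at hprod
    linarith
  have hlog : 0 ≤ ∑ i, Real.log (hh.eigenvalues i) := by
    rw [← Real.log_prod fun i _ => (hpos i).ne']
    exact Real.log_nonneg hprod
  -- `log λ ≤ λ - 1`, strictly unless `λ = 1`, while `∑ log λ ≥ 0 = ∑ (λ - 1)`.
  have h1 : ∀ i, hh.eigenvalues i = 1 := by
    by_contra! ⟨i, hi⟩
    have : ∑ i, Real.log (hh.eigenvalues i) < ∑ i, (hh.eigenvalues i - 1) :=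
      Finset.sum_lt_sum (fun j _ => Real.log_le_sub_one_of_pos (hpos j))
        ⟨i, Finset.mem_univ i, Real.log_lt_sub_one_of_pos (hpos i) hi⟩
    simp [Finset.sum_sub_distrib, hsum] at this
    linarith
  have hd : diagonal (RCLike.ofReal ∘ hh.eigenvalues : Fin m → ℂ) = 1 := by
    rw [← diagonal_one]
    congr 1
    funext i
    simp [h1]
  rw [hh.spectral_theorem, hd, map_one]

lemma inner_complex_eq {m : ℕ} (x y : Cn m) :
    inner ℂ x y = ∑ k, (starRingEnd ℂ (x k)) * y k := by
  simp [PiLp.inner_apply, mul_comm]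

lemma re_inner_complex {m : ℕ} (x y : Cn m) : (inner ℂ x y).re = inner ℝ x y := by
  simp [PiLp.inner_apply, Complex.inner, mul_comm]

/-- The matrix with columns `v j`. -/
def colMatrix {m : ℕ} (v : Fin m → Cn m) : Matrix (Fin m) (Fin m) ℂ := of fun i j => v j i

lemma holVolForm_eq_det {m : ℕ} (v : Fin m → Cn m) : holVolForm v = (colMatrix v).det := rfl

lemma gram_eq_conjTranspose_mul_colMatrix {m : ℕ} (v : Fin m → Cn m) :
    gram ℂ v = (colMatrix v)ᴴ * colMatrix v := by
  ext i j
  simp [gram_apply, inner_complex_eq, mul_apply, colMatrix]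

lemma map_re_gram {m : ℕ} (v : Fin m → Cn m) : (gram ℂ v).map Complex.re = gram ℝ v := by
  ext i j
  simp [gram_apply, re_inner_complex]

lemma map_re_mul_mul {m : ℕ} (P Q : Matrix (Fin m) (Fin m) ℝ) (H : Matrix (Fin m) (Fin m) ℂ) :
    (P.map ((↑) : ℝ → ℂ) * H * Q.map ((↑) : ℝ → ℂ)).map Complex.re = P * H.map Complex.re * Q := by
  ext i j
  simp [mul_apply]

lemma det_map_ofReal {m : ℕ} (P : Matrix (Fin m) (Fin m) ℝ) :
    (P.map ((↑) : ℝ → ℂ)).det = (P.det : ℂ) :=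
  (Complex.ofRealHom.map_det P).symm

lemma exists_real_factor {m : ℕ} {S : Matrix (Fin m) (Fin m) ℝ} (hS : S.PosDef) :
    ∃ B : Matrix (Fin m) (Fin m) ℝ, IsUnit B.det ∧ S = Bᵀ * B := by
  open scoped MatrixOrder in
  obtain ⟨B, hB⟩ := CStarAlgebra.nonneg_iff_eq_star_mul_self.mp hS.posSemidef.nonneg
  have hB' : S = Bᵀ * B := by simpa [star_eq_conjTranspose] using hB
  refine ⟨B, ?_, hB'⟩
  have := hS.det_pos
  rw [hB', det_mul, det_transpose] at this
  exact isUnit_iff_ne_zero.2 fun h => by simp [h] at this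

/-- The vectors `v` form a real basis of a special Lagrangian plane (up to orientation). -/
def IsCalibratedFrame {m : ℕ} (v : Fin m → Cn m) : Prop :=
  (holVolForm v).re ^ 2 = (gram ℝ v).det ∧ (gram ℝ v).det ≠ 0

/-- Calibrated planes are Lagrangian. After a real change of basis making the frame orthonormal, the
Hermitian Gram matrix `H` has real part 1, hence trace `m`, and determinant at least 1. The equality
case of AM-GM forces `H = 1`, and undoing the change of basis gives a real matrix. -/
lemma IsCalibratedFrame.gram_eq {m : ℕ} {v : Fin m → Cn m} (h : IsCalibratedFrame v) :
    gram ℂ v = (gram ℝ v).map ((↑) : ℝ → ℂ) := by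
  obtain ⟨h1, h0⟩ := h
  have hS : (gram ℝ v).PosDef := (posSemidef_gram (𝕜 := ℝ) v).posDef_iff_det_ne_zero.2 h0
  obtain ⟨B, hB, hSB⟩ := exists_real_factor hS
  have hBi : B * B⁻¹ = 1 := mul_nonsing_inv B hB
  have hiB : B⁻¹ * B = 1 := nonsing_inv_mul B hB
  set R : Matrix (Fin m) (Fin m) ℂ := B⁻¹.map ((↑) : ℝ → ℂ) with hR
  have hRH : Rᴴ = (B⁻¹)ᵀ.map ((↑) : ℝ → ℂ) := by
    ext i j
    simp [hR]
  set H := Rᴴ * gram ℂ v * R with hH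
  have hpsd : H.PosSemidef := (posSemidef_gram (𝕜 := ℂ) v).conjTranspose_mul_mul_same R
  have hre : H.map Complex.re = 1 := by
    rw [hH, hRH, hR, map_re_mul_mul, map_re_gram, hSB]
    calc (B⁻¹)ᵀ * (Bᵀ * B) * B⁻¹ = (B * B⁻¹)ᵀ * (B * B⁻¹) := by
          simp only [transpose_mul, Matrix.mul_assoc]
      _ = 1 := by simp [hBi]
  have htr : H.trace = m := by
    have : ∀ i, H i i = 1 := fun i => by
      have hr : (H i i).re = 1 := by simpa using congrFun (congrFun hre i) i
      have hi : (H i i).im = 0 := by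
        have := congrFun (congrFun hpsd.isHermitian i) i
        rw [conjTranspose_apply] at this
        exact Complex.conj_eq_iff_im.1 this
      exact Complex.ext (by simpa using hr) (by simpa using hi)
    simp [trace, this]
  -- `det H` is `|Ω(v)|² / det g`, and calibration says `det g = (Re Ω(v))² ≤ |Ω(v)|²`.
  have hdet : 1 ≤ H.det.re := by
    have e : H.det = (((B⁻¹).det ^ 2 * Complex.normSq (holVolForm v) : ℝ) : ℂ) := by
      rw [hH, gram_eq_conjTranspose_mul_colMatrix]
      simp only [det_mul, det_conjTranspose, ← holVolForm_eq_det]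
      rw [hR, det_map_ofReal]
      push_cast
      rw [Complex.normSq_eq_conj_mul_self]
      simp
      ring
    rw [e, Complex.ofReal_re]
    have hd : (B⁻¹).det ^ 2 * (gram ℝ v).det = 1 := by
      have := congrArg det hBi
      simp only [det_mul, det_one] at this
      rw [hSB]
      simp only [det_mul, det_transpose]
      calc (B⁻¹).det ^ 2 * (B.det * B.det) = (B.det * (B⁻¹).det) ^ 2 := by ring
        _ = 1 := by rw [this]; ring
    rw [← hd, ← h1, Complex.normSq_apply]
    gcongr
    nlinarith [sq_nonneg (holVolForm v).im]
  have hone := eq_one_of_posSemidef hpsd htr hdet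
  set Bc : Matrix (Fin m) (Fin m) ℂ := B.map ((↑) : ℝ → ℂ) with hBc
  have hRB : R * Bc = 1 := by
    have := congrArg (fun M : Matrix (Fin m) (Fin m) ℝ => M.map Complex.ofRealHom) hiB
    simp only [Matrix.map_mul, Matrix.map_one _ (map_zero _) (map_one _)] at this
    exact this
  have hBcH : Bcᴴ = Bᵀ.map ((↑) : ℝ → ℂ) := by
    ext i j
    simp [hBc]
  calc gram ℂ v = (R * Bc)ᴴ * gram ℂ v * (R * Bc) := by simp [hRB]
    _ = Bcᴴ * H * Bc := by simp only [hH, conjTranspose_mul, Matrix.mul_assoc]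
    _ = Bcᴴ * Bc := by rw [hone, Matrix.mul_one]
    _ = (gram ℝ v).map ((↑) : ℝ → ℂ) := by
      rw [hBcH, hBc, hSB]
      exact (Matrix.map_mul (f := Complex.ofRealHom)).symm

/-- The determinant of the Hermitian Gram matrix is `|Ω(v)|²`; as that matrix is the real one, it is
also `(Re Ω(v))²`. -/
lemma IsCalibratedFrame.im_eq_zero {m : ℕ} {v : Fin m → Cn m} (h : IsCalibratedFrame v) :
    (holVolForm v).im = 0 := by
  have h1 := congrArg det h.gram_eq
  rw [det_map_ofReal, gram_eq_conjTranspose_mul_colMatrix, det_mul, det_conjTranspose,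
    ← holVolForm_eq_det, ← h.1] at h1
  have h2 : star (holVolForm v) * holVolForm v = (Complex.normSq (holVolForm v) : ℂ) :=
    Complex.normSq_eq_conj_mul_self.symm
  rw [h2] at h1
  have h3 : Complex.normSq (holVolForm v) = (holVolForm v).re ^ 2 := by exact_mod_cast h1
  rw [Complex.normSq_apply] at h3
  nlinarith

lemma IsCalibratedFrame.im_inner {m : ℕ} {v : Fin m → Cn m} (h : IsCalibratedFrame v)
    (i j : Fin m) : (inner ℂ (v i) (v j)).im = 0 := by
  have := congrFun (congrFun h.gram_eq i) j
  rw [gram_apply] at this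
  rw [this]
  simp

lemma IsCalibratedFrame.re_ne_zero {m : ℕ} {v : Fin m → Cn m} (h : IsCalibratedFrame v) :
    (holVolForm v).re ≠ 0 := fun h0 => h.2 (by rw [← h.1, h0]; ring)

lemma IsCalibratedFrame.ne_zero {m : ℕ} {v : Fin m → Cn m} (h : IsCalibratedFrame v) :
    holVolForm v ≠ 0 := fun h0 => h.re_ne_zero (by simp [h0])

lemma colMatrix_update {m : ℕ} (v : Fin m → Cn m) (i : Fin m) (w : Cn m) :
    colMatrix (Function.update v i w) = (colMatrix v).updateCol i w.ofLp := by
  ext a b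
  by_cases h : b = i
  · subst h; simp [colMatrix]
  · simp [colMatrix, h]

lemma holVolForm_update {m : ℕ} (v : Fin m → Cn m) (i : Fin m) (w : Cn m) :
    holVolForm (Function.update v i w) = (colMatrix v).cramer w.ofLp i := by
  rw [holVolForm_eq_det, colMatrix_update, cramer_apply]

/-- Cramer's rule for a frame of a special Lagrangian plane. -/
lemma IsCalibratedFrame.sum_gram_mul {m : ℕ} {v : Fin m → Cn m} (h : IsCalibratedFrame v)
    (w : Cn m) (j : Fin m) :
    ∑ i, gram ℝ v j i * (holVolForm (Function.update v i w)).re =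
      (holVolForm v).re * inner ℝ (v j) w := by
  have h1 : (gram ℂ v *ᵥ (colMatrix v).cramer w.ofLp) j = holVolForm v * inner ℂ (v j) w := by
    rw [gram_eq_conjTranspose_mul_colMatrix, ← mulVec_mulVec, mulVec_cramer, mulVec_smul]
    simp [holVolForm_eq_det, inner_complex_eq, mulVec, dotProduct, colMatrix]
  rw [h.gram_eq] at h1
  have h2 := congrArg Complex.re h1
  simp only [mulVec, dotProduct, Complex.re_sum, map_apply,
    Complex.mul_re, h.im_eq_zero, zero_mul, sub_zero, re_inner_complex,
    Complex.ofReal_re, Complex.ofReal_im] at h2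
  simpa only [holVolForm_update] using h2

/-- By Cramer's rule the `i`-th summand is `det M` times the `i`-th diagonal entry of `M⁻¹ B M`,
where `M` has columns `v`, and the trace is invariant under conjugation. -/
lemma sum_holVolForm_update {m : ℕ} (v : Fin m → Cn m) (hv : holVolForm v ≠ 0)
    (B : Matrix (Fin m) (Fin m) ℂ) :
    ∑ i, holVolForm (Function.update v i (toEuclideanLin B (v i))) = B.trace * holVolForm v := by
  set M := colMatrix v with hM
  have hu : IsUnit M.det := isUnit_iff_ne_zero.2 hv
  have h1 : ∀ i, holVolForm (Function.update v i (toEuclideanLin B (v i))) =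
      M.det * (M⁻¹ * B * M) i i := by
    intro i
    have hc : M.cramer (toEuclideanLin B (v i)).ofLp = M.det • (M⁻¹ *ᵥ (B *ᵥ (v i).ofLp)) := by
      have h2 := mulVec_cramer M (toEuclideanLin B (v i)).ofLp
      have h3 := congrArg (fun x => M⁻¹ *ᵥ x) h2
      simp only [mulVec_mulVec, nonsing_inv_mul M hu, one_mulVec, mulVec_smul] at h3
      rw [h3]
      simp [toLpLin_apply]
    rw [holVolForm_update, hc, Matrix.mul_assoc]
    rw [Pi.smul_apply, smul_eq_mul, mul_apply]
    congr 1
  simp only [h1, ← Finset.mul_sum]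
  have : ∑ i, (M⁻¹ * B * M) i i = B.trace := by
    change (M⁻¹ * B * M).trace = _
    rw [Matrix.trace_mul_comm, ← Matrix.mul_assoc, mul_nonsing_inv M hu, Matrix.one_mul]
  rw [this, mul_comm]
  rfl

/-- The form `dz_1 ∧ ⋯ ∧ dz_m` as an alternating map. -/
def holVolAlt (m : ℕ) : (Cn m) [⋀^Fin m]→L[ℝ] ℂ where
  toMultilinearMap := MultilinearMap.restrictScalars ℝ
    ((detRowAlternating (n := Fin m) (R := ℂ)).compLinearMap
      (WithLp.linearEquiv 2 ℂ (Fin m → ℂ)).toLinearMap).toMultilinearMap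
  cont := by
    change Continuous fun v : Fin m → Cn m => det (of fun i j => v i j)
    refine Continuous.matrix_det (continuous_matrix fun i j => ?_)
    exact (PiLp.continuous_apply 2 _ j).comp (continuous_apply i)
  map_eq_zero_of_eq' := fun v i j h hij =>
    ((detRowAlternating (n := Fin m) (R := ℂ)).compLinearMap
      (WithLp.linearEquiv 2 ℂ (Fin m → ℂ)).toLinearMap).map_eq_zero_of_eq v h hij

lemma holVolAlt_apply {m : ℕ} (v : Fin m → Cn m) : holVolAlt m v = holVolForm v := by
  rw [holVolForm, ← det_transpose]
  rfl

end LinearAlgebra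

lemma one_add_one_le_infty : (1 + 1 : WithTop ℕ∞) ≤ ∞ := by
  exact WithTop.coe_le_coe.2 (le_top : (1 + 1 : ℕ∞) ≤ ⊤)

/-! ### Local parametrizations, tangent spaces and integral curves -/

section Charts

open Filter Topology Set

variable {E : Type*} [NormedAddCommGroup E] [InnerProductSpace ℝ E]
variable {L : Set E} {k : ℕ} {φ : EuclideanSpace ℝ (Fin k) → E}
  {V : Set (EuclideanSpace ℝ (Fin k))} {y : EuclideanSpace ℝ (Fin k)}

lemma IsLocalParam.mem (h : IsLocalParam L k φ V) (hy : y ∈ V) : φ y ∈ L := by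
  obtain ⟨U, -, hU⟩ := h.image_open
  exact (hU ▸ mem_image_of_mem φ hy : φ y ∈ L ∩ U).1

lemma IsLocalParam.contDiffAt (h : IsLocalParam L k φ V) (hy : y ∈ V) : ContDiffAt ℝ ∞ φ y :=
  h.contDiffOn.contDiffAt (h.isOpen.mem_nhds hy)

lemma IsLocalParam.differentiableAt (h : IsLocalParam L k φ V) (hy : y ∈ V) :
    DifferentiableAt ℝ φ y :=
  (h.contDiffAt hy).differentiableAt (by simp)

/-- Points of `L` near `φ y` are the images of points near `y`. -/
lemma IsLocalParam.eventually_of_nhds (h : IsLocalParam L k φ V) (hy : y ∈ V)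
    {p : EuclideanSpace ℝ (Fin k) → Prop} (hp : ∀ᶠ z in 𝓝 y, p z) :
    ∀ᶠ x in 𝓝 (φ y), x ∈ L → ∃ z ∈ V, p z ∧ φ z = x := by
  obtain ⟨U, hU, hUV⟩ := h.image_open
  have hyU : φ y ∈ U := (hUV ▸ mem_image_of_mem φ hy : φ y ∈ L ∩ U).2
  have h1 : ∀ᶠ z : V in 𝓝 (⟨y, hy⟩ : V), p z :=
    continuous_subtype_val.continuousAt.eventually hp
  rw [h.isEmbedding.nhds_eq_comap, eventually_comap] at h1
  have h2 : ∀ᶠ x in 𝓝 (φ y), ∀ z : V, V.domRestrict φ z = x → p z := h1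
  filter_upwards [h2, hU.mem_nhds hyU] with x hx hxU hxL
  obtain ⟨z, hz, rfl⟩ : x ∈ φ '' V := hUV ▸ ⟨hxL, hxU⟩
  exact ⟨z, hz, hx ⟨z, hz⟩ rfl, rfl⟩

/-- A local parametrization has a smooth local left inverse. -/
lemma IsLocalParam.exists_leftInverse [FiniteDimensional ℝ E] (h : IsLocalParam L k φ V)
    (hy : y ∈ V) : ∃ ρ : E → EuclideanSpace ℝ (Fin k), ContDiffAt ℝ ∞ ρ (φ y) ∧
      (∀ᶠ z in 𝓝 y, ρ (φ z) = z) ∧ ∀ᶠ x in 𝓝 (φ y), x ∈ L → φ (ρ x) = x := by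
  -- `P ∘ φ` has derivative the identity at `y`, so the inverse function theorem applies to it; `ρ`
  -- is its local inverse after `P`.
  obtain ⟨P, hP⟩ := (fderiv ℝ φ y).toLinearMap.exists_leftInverse_of_injective
    (LinearMap.ker_eq_bot.2 (h.injective_fderiv y hy))
  let Pc : E →L[ℝ] EuclideanSpace ℝ (Fin k) := LinearMap.toContinuousLinearMap P
  have hg : ContDiffAt ℝ ∞ (Pc ∘ φ) y := Pc.contDiff.contDiffAt.comp y (h.contDiffAt hy)
  have hg' : HasFDerivAt (Pc ∘ φ)
      (ContinuousLinearEquiv.refl ℝ (EuclideanSpace ℝ (Fin k)) :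
        EuclideanSpace ℝ (Fin k) →L[ℝ] EuclideanSpace ℝ (Fin k)) y := by
    refine (Pc.hasFDerivAt.comp y (h.differentiableAt hy).hasFDerivAt).congr_fderiv ?_
    ext1 w
    exact LinearMap.congr_fun hP w
  have hn : (∞ : WithTop ℕ∞) ≠ 0 := by simp
  have h1 : ∀ᶠ z in 𝓝 y, hg.localInverse hg' hn (Pc (φ z)) = z :=
    (hg.hasStrictFDerivAt' hg' hn).eventually_left_inverse
  refine ⟨hg.localInverse hg' hn ∘ Pc, ?_, h1, ?_⟩
  · exact (hg.to_localInverse hg' hn).comp (φ y) Pc.contDiff.contDiffAt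
  · filter_upwards [h.eventually_of_nhds hy h1] with x hx hxL
    obtain ⟨z, -, hz, rfl⟩ := hx hxL
    simp only [Function.comp_apply, hz]

/-- A differentiable map into `L` has derivative in the tangent space of `L`. -/
lemma IsLocalParam.mem_range_fderiv [FiniteDimensional ℝ E] (h : IsLocalParam L k φ V)
    (hy : y ∈ V) {F : Type*} [NormedAddCommGroup F] [NormedSpace ℝ F] {f : F → E} {f' : F →L[ℝ] E}
    {p : F} (hf : HasFDerivAt f f' p) (hp : f p = φ y) (hfL : ∀ᶠ q in 𝓝 p, f q ∈ L) (w : F) :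
    f' w ∈ LinearMap.range (fderiv ℝ φ y).toLinearMap := by
  obtain ⟨ρ, hρ, hl, hr⟩ := h.exists_leftInverse hy
  have hρd : HasFDerivAt ρ (fderiv ℝ ρ (f p)) (f p) :=
    hp ▸ (hρ.differentiableAt (by simp)).hasFDerivAt
  have hρy : ρ (f p) = y := by rw [hp]; exact hl.self_of_nhds
  have hφ : HasFDerivAt φ (fderiv ℝ φ y) (ρ (f p)) :=
    hρy.symm ▸ (h.differentiableAt hy).hasFDerivAt
  have h1 : HasFDerivAt (fun q => φ (ρ (f q)))
      ((fderiv ℝ φ y).comp ((fderiv ℝ ρ (f p)).comp f')) p :=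
    hφ.comp p (hρd.comp p hf)
  have h2 : (fun q => φ (ρ (f q))) =ᶠ[𝓝 p] f := by
    rw [← hp] at hr
    filter_upwards [hfL, hf.continuousAt.eventually hr] with q hq hq'
    exact hq' hq
  have h3 := h1.unique (hf.congr_of_eventuallyEq h2)
  exact ⟨fderiv ℝ ρ (f p) (f' w), DFunLike.congr_fun h3 w⟩

/-- The tangent space at `x` of the `k`-dimensional submanifold `L`. -/
def tangentSet (L : Set E) (k : ℕ) (x : E) : Set E :=
  {w | ∃ φ V y, IsLocalParam L k φ V ∧ y ∈ V ∧ φ y = x ∧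
    w ∈ LinearMap.range (fderiv ℝ φ y).toLinearMap}

lemma IsLocalParam.mem_tangentSet_iff [FiniteDimensional ℝ E] (h : IsLocalParam L k φ V)
    (hy : y ∈ V) {w : E} :
    w ∈ tangentSet L k (φ y) ↔ w ∈ LinearMap.range (fderiv ℝ φ y).toLinearMap := by
  refine ⟨?_, fun hw => ⟨φ, V, y, h, hy, rfl, hw⟩⟩
  rintro ⟨ψ, W, z, hψ, hz, hzy, ⟨u, rfl⟩⟩
  refine h.mem_range_fderiv hy (hψ.differentiableAt hz).hasFDerivAt hzy ?_ u
  filter_upwards [hψ.isOpen.mem_nhds hz] with q hq using hψ.mem hq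

/-- An integral curve of a vector field tangent to `L` that starts in `L` stays in `L` locally. -/
lemma IsLocalParam.eventually_mem_of_integralCurve [FiniteDimensional ℝ E]
    (h : IsLocalParam L k φ V) (hy : y ∈ V) {X : E → E} {K : NNReal} (hX : ContDiff ℝ ∞ X)
    (hK : LipschitzWith K X) (htan : ∀ x ∈ L, X x ∈ tangentSet L k x) {c : ℝ → E}
    (hc : ∀ t, HasDerivAt c (X (c t)) t) {t₀ : ℝ} (ht₀ : c t₀ = φ y) :
    ∀ᶠ t in 𝓝 t₀, c t ∈ L := by
  obtain ⟨ρ, hρ, hl, hr⟩ := h.exists_leftInverse hy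
  -- `Y` is `X` read in the chart. Its integral curve `α` maps to a curve in `L`, and uniqueness for
  -- the Lipschitz field `X` identifies `φ ∘ α` with `c`.
  let Y : EuclideanSpace ℝ (Fin k) → EuclideanSpace ℝ (Fin k) := fun z => fderiv ℝ ρ (φ z) (X (φ z))
  have hφ1 : ContDiffAt ℝ 1 φ y := (h.contDiffAt hy).of_le (by simp)
  have hY : ContDiffAt ℝ 1 Y y := by
    have h1 : ContDiffAt ℝ 1 (fderiv ℝ ρ) (φ y) := hρ.fderiv_right one_add_one_le_infty
    exact (h1.comp y hφ1).clm_apply ((hX.of_le (by simp)).contDiffAt.comp y hφ1)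
  obtain ⟨α, hα0, ε, hε, hα⟩ :=
    hY.exists_forall_mem_closedBall_exists_eq_forall_mem_Ioo_hasDerivAt₀ t₀
  have hαc : ContinuousAt α t₀ := (hα t₀ ⟨by linarith, by linarith⟩).continuousAt
  have hρe : ∀ᶠ x in 𝓝 (φ y), DifferentiableAt ℝ ρ x := by
    filter_upwards [(hρ.of_le (m := 1) (by simp)).eventually (by simp)] with x hx
    exact hx.differentiableAt (by simp)
  -- Only here is tangency used: `X (φ z) = dφ u` for some `u`, and `dρ ∘ dφ = id` recovers `u = Y
  -- z`.
  have hgood : ∀ᶠ z in 𝓝 y, z ∈ V ∧ fderiv ℝ φ z (Y z) = X (φ z) := by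
    filter_upwards [h.isOpen.mem_nhds hy, hl.eventually_nhds,
      (h.differentiableAt hy).continuousAt.eventually hρe] with z hz hlz hρz
    refine ⟨hz, ?_⟩
    obtain ⟨u, hu⟩ := (h.mem_tangentSet_iff hz).1 (htan _ (h.mem hz))
    have h1 : HasFDerivAt (fun q => ρ (φ q)) ((fderiv ℝ ρ (φ z)).comp (fderiv ℝ φ z)) z :=
      hρz.hasFDerivAt.comp z (h.differentiableAt hz).hasFDerivAt
    have h2 : (fun q => ρ (φ q)) =ᶠ[𝓝 z] id := hlz
    have h3 := h1.unique ((hasFDerivAt_id z).congr_of_eventuallyEq h2)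
    have h4 : fderiv ℝ ρ (φ z) (fderiv ℝ φ z u) = u := DFunLike.congr_fun h3 u
    change fderiv ℝ φ z u = X (φ z) at hu
    simp only [Y]
    rw [← hu, h4]
  have hαgood : ∀ᶠ t in 𝓝 t₀, α t ∈ V ∧ fderiv ℝ φ (α t) (Y (α t)) = X (φ (α t)) := by
    rw [← hα0] at hgood
    exact hαc.eventually hgood
  have hβ : ∀ᶠ t in 𝓝 t₀, HasDerivAt (fun s => φ (α s)) (X (φ (α t))) t ∧
      φ (α t) ∈ (univ : Set E) := by
    filter_upwards [hαgood, Ioo_mem_nhds (by linarith : t₀ - ε < t₀) (by linarith : t₀ < t₀ + ε)]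
      with t ht hte
    refine ⟨?_, mem_univ _⟩
    have := (h.differentiableAt ht.1).hasFDerivAt.comp_hasDerivAt t (hα t hte)
    rwa [ht.2] at this
  have huniq := ODE_solution_unique_of_eventually (v := fun _ => X) (s := fun _ => univ) (K := K)
    (Eventually.of_forall fun _ => hK.lipschitzOnWith)
    (Eventually.of_forall fun t => ⟨hc t, mem_univ _⟩) hβ (by rw [hα0, ht₀])
  filter_upwards [huniq, hαgood] with t ht hαt
  rw [ht]
  exact h.mem hαt.1

lemma pullback_apply {E : Type*} {L : Set E} {u : L → ℝ} {φ : EuclideanSpace ℝ (Fin k) → E}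
    (hy : φ y ∈ L) :
    pullback u φ y = u ⟨φ y, hy⟩ :=
  Subtype.val_injective.extend_apply u 0 ⟨φ y, hy⟩

lemma IsLocalParam.linearIndependent (h : IsLocalParam L k φ V) (hy : y ∈ V) :
    LinearIndependent ℝ fun i => pderiv φ i y :=
  Matrix.linearIndependent_of_det_gram_ne_zero (h.det_metric_pos hy).ne'

lemma fderiv_eq_sum_pderiv {F : Type*} [NormedAddCommGroup F] [NormedSpace ℝ F]
    (f : EuclideanSpace ℝ (Fin k) → F) (y w : EuclideanSpace ℝ (Fin k)) :
    fderiv ℝ f y w = ∑ i, w i • pderiv f i y := by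
  have h := (EuclideanSpace.basisFun (Fin k) ℝ).sum_repr w
  simp only [EuclideanSpace.basisFun_repr, EuclideanSpace.basisFun_apply] at h
  conv_lhs => rw [← h]
  simp [pderiv]

end Charts

/-! ### Change of frame, orientation sign, derivatives of the volume form -/

section Frames

open Filter Topology Set Matrix

lemma colMatrix_sum_smul {m : ℕ} (v : Fin m → Cn m) (T : Matrix (Fin m) (Fin m) ℝ) :
    colMatrix (fun i => ∑ j, T j i • v j) = colMatrix v * T.map ((↑) : ℝ → ℂ) := by
  ext a i
  simp [colMatrix, mul_apply, mul_comm]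

/-- Both `(Re Ω)²` and the Gram determinant scale by `(det T)²`. -/
lemma IsCalibratedFrame.sum_smul {m : ℕ} {v : Fin m → Cn m} (h : IsCalibratedFrame v)
    (T : Matrix (Fin m) (Fin m) ℝ) (hT : LinearIndependent ℝ fun i => ∑ j, T j i • v j) :
    IsCalibratedFrame fun i => ∑ j, T j i • v j := by
  refine ⟨?_, det_gram_ne_zero_iff_linearIndependent.2 hT⟩
  have e : (T.map ((↑) : ℝ → ℂ))ᴴ = Tᵀ.map ((↑) : ℝ → ℂ) := by
    ext i j
    simp
  rw [holVolForm_eq_det, ← map_re_gram, gram_eq_conjTranspose_mul_colMatrix, colMatrix_sum_smul,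
    conjTranspose_mul, e, Matrix.mul_assoc, ← Matrix.mul_assoc (colMatrix v)ᴴ, ← Matrix.mul_assoc,
    ← gram_eq_conjTranspose_mul_colMatrix, map_re_mul_mul, map_re_gram]
  simp only [det_mul, det_map_ofReal, ← holVolForm_eq_det, det_transpose, ← h.1,
    Complex.re_mul_ofReal]
  ring

/-- The definition provides just one calibrated parametrization around each point, whereas
harmonicity is tested in all of them, including the orientation-reversing ones. Squaring `Re Ω`
makes the condition independent of the basis. -/
lemma IsSpecialLagrangian.isCalibratedFrame {m : ℕ} {L : Set (Cn m)} (hL : IsSpecialLagrangian L)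
    {x : Cn m} (hx : x ∈ L) {v : Fin m → Cn m} (hv : LinearIndependent ℝ v)
    (ht : ∀ i, v i ∈ tangentSet L m x) : IsCalibratedFrame v := by
  obtain ⟨φ, V, hφ, ⟨y, hy, rfl⟩, hcal⟩ := hL x hx
  have h0 : IsCalibratedFrame fun i => pderiv φ i y := by
    refine ⟨?_, (hφ.det_metric_pos hy).ne'⟩
    rw [hcal y hy, volDensity, Real.sq_sqrt (hφ.det_metric_pos hy).le]
    rfl
  have h1 : ∀ i, ∃ u, fderiv ℝ φ y u = v i := fun i => (hφ.mem_tangentSet_iff hy).1 (ht i)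
  choose u hu using h1
  have h2 : v = fun i => ∑ j, (of fun j i => u i j : Matrix (Fin m) (Fin m) ℝ) j i • pderiv φ j y := by
    funext i
    rw [← hu i, fderiv_eq_sum_pderiv]
    rfl
  rw [h2] at hv ⊢
  exact h0.sum_smul _ hv

/-- The coordinate frame of a special Lagrangian. -/
lemma IsSpecialLagrangian.isCalibratedFrame_pderiv {m : ℕ} {L : Set (Cn m)}
    (hL : IsSpecialLagrangian L) {φ : EuclideanSpace ℝ (Fin m) → Cn m}
    {V : Set (EuclideanSpace ℝ (Fin m))} (h : IsLocalParam L m φ V)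
    {z : EuclideanSpace ℝ (Fin m)} (hz : z ∈ V) : IsCalibratedFrame fun i => pderiv φ i z :=
  hL.isCalibratedFrame (h.mem hz) (h.linearIndependent hz) fun _ =>
    (h.mem_tangentSet_iff hz).2 ⟨_, rfl⟩

/-- The orientation sign of a continuous family of special Lagrangian frames is locally constant. -/
lemma exists_sign {m : ℕ} {X : Type*} [TopologicalSpace X] {v : X → Fin m → Cn m} {y : X}
    (hv : ContinuousAt v y) (hcal : ∀ᶠ z in 𝓝 y, IsCalibratedFrame (v z)) :
    ∃ ε : ℝ, ε * ε = 1 ∧ ∀ᶠ z in 𝓝 y, (holVolForm (v z)).re = ε * √(gram ℝ (v z)).det := by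
  have hc : ContinuousAt (fun z => (holVolForm (v z)).re) y := by
    have := Complex.continuous_re.continuousAt.comp ((holVolAlt m).cont.continuousAt.comp hv)
    refine this.congr (Eventually.of_forall fun z => ?_)
    exact congrArg Complex.re (holVolAlt_apply (v z))
  rcases lt_or_gt_of_ne hcal.self_of_nhds.re_ne_zero with h | h
  · refine ⟨-1, by norm_num, ?_⟩
    filter_upwards [hc.eventually_lt continuousAt_const h, hcal] with z hz hcz
    rw [← hcz.1, Real.sqrt_sq_eq_abs, abs_of_neg hz]
    ring
  · refine ⟨1, by norm_num, ?_⟩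
    filter_upwards [continuousAt_const.eventually_lt hc h, hcal] with z hz hcz
    rw [← hcz.1, Real.sqrt_sq_eq_abs, abs_of_pos hz, one_mul]

lemma holVolForm_swap {m : ℕ} (v : Fin m → Cn m) {i j : Fin m} (hij : i ≠ j) :
    holVolForm (v ∘ Equiv.swap i j) = -holVolForm v := by
  rw [← holVolAlt_apply, ← holVolAlt_apply]
  exact (holVolAlt m).toAlternatingMap.map_swap v hij

lemma holVolForm_update_update_swap {m : ℕ} (v : Fin m → Cn m) {i j : Fin m} (hij : i ≠ j)
    (w h : Cn m) :
    holVolForm (Function.update (Function.update v j w) i h) =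
      -holVolForm (Function.update (Function.update v i w) j h) := by
  rw [← holVolForm_swap _ hij]
  congr 1
  funext k
  by_cases hi : k = i
  · subst hi; simp
  · by_cases hj : k = j
    · subst hj; simp [hij, hi]
    · simp [hi, hj, Equiv.swap_apply_of_ne_of_ne]

lemma sum_sum_eq_zero_of_antisymm {σ : Type*} [Fintype σ] {a : σ → σ → ℂ}
    (h : ∀ i j, a j i = -a i j) : ∑ i, ∑ j, a i j = 0 := by
  have h1 : ∑ i, ∑ j, a i j = -∑ i, ∑ j, a i j := by
    conv_lhs => rw [Finset.sum_comm]
    simp only [← Finset.sum_neg_distrib]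
    exact Finset.sum_congr rfl fun i _ => Finset.sum_congr rfl fun j _ => h i j
  exact self_eq_neg.1 h1

/-- The second derivatives cancel in the divergence of a cofactor field. -/
lemma sum_sum_holVolForm_update_update {m : ℕ} {σ : Type*} [Fintype σ] [DecidableEq σ]
    (v : Fin m → Cn m) (w : Cn m) {e : σ → Fin m} (he : Function.Injective e)
    {H : σ → σ → Cn m} (hH : ∀ i j, H i j = H j i) :
    ∑ i, ∑ j, (if j = i then 0 else
      holVolForm (Function.update (Function.update v (e i) w) (e j) (H i j))) = 0 := by
  refine sum_sum_eq_zero_of_antisymm fun i j => ?_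
  by_cases hij : i = j
  · simp [hij]
  · rw [if_neg hij, if_neg (Ne.symm hij), hH j i]
    exact holVolForm_update_update_swap v (he.ne hij) w _

/-- Leibniz rule for a multilinear form. -/
lemma hasFDerivAt_holVolForm {m : ℕ} {F : Type*} [NormedAddCommGroup F] [NormedSpace ℝ F]
    {u : F → Fin m → Cn m} {u' : Fin m → F →L[ℝ] Cn m} {y : F}
    (hu : ∀ j, HasFDerivAt (fun z => u z j) (u' j) y) :
    ∃ D : F →L[ℝ] ℂ, HasFDerivAt (fun z => holVolForm (u z)) D y ∧
      ∀ e, D e = ∑ j, holVolForm (Function.update (u y) j (u' j e)) := by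
  have h1 : HasFDerivAt u (ContinuousLinearMap.pi u') y := hasFDerivAt_pi.2 hu
  have h2 := ((holVolAlt m).hasFDerivAt (u y)).comp y h1
  refine ⟨_, h2.congr_of_eventuallyEq (Eventually.of_forall fun z => (holVolAlt_apply _).symm), ?_⟩
  intro e
  simp [ContinuousMultilinearMap.linearDeriv_apply, ← holVolAlt_apply]

lemma pderiv_holVolForm {m k : ℕ} {u : EuclideanSpace ℝ (Fin k) → Fin m → Cn m}
    {y : EuclideanSpace ℝ (Fin k)} (hu : ∀ j, DifferentiableAt ℝ (fun z => u z j) y) (i : Fin k) :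
    pderiv (fun z => (holVolForm (u z)).re) i y =
      (∑ j, holVolForm (Function.update (u y) j (pderiv (fun z => u z j) i y))).re := by
  obtain ⟨D, hD, hDe⟩ := hasFDerivAt_holVolForm fun j => (hu j).hasFDerivAt
  have h : HasFDerivAt (fun z => (holVolForm (u z)).re) (Complex.reCLM.comp D) y :=
    Complex.reCLM.hasFDerivAt.comp y hD
  rw [pderiv, h.fderiv, ContinuousLinearMap.comp_apply, hDe]
  rfl

lemma pderiv_comm {k : ℕ} {F : Type*} [NormedAddCommGroup F] [NormedSpace ℝ F]
    {f : EuclideanSpace ℝ (Fin k) → F} {y : EuclideanSpace ℝ (Fin k)} (hf : ContDiffAt ℝ ∞ f y)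
    (i j : Fin k) : pderiv (pderiv f j) i y = pderiv (pderiv f i) j y := by
  have hd : DifferentiableAt ℝ (fderiv ℝ f) y :=
    (hf.fderiv_right (m := 1) one_add_one_le_infty).differentiableAt (by simp)
  have h1 : ∀ a b : Fin k, pderiv (pderiv f a) b y =
      fderiv ℝ (fderiv ℝ f) y (EuclideanSpace.single b 1) (EuclideanSpace.single a 1) := by
    intro a b
    have := hd.hasFDerivAt.clm_apply (hasFDerivAt_const (EuclideanSpace.single a (1 : ℝ)) y)
    have h2 : pderiv f a = fun z => fderiv ℝ f z (EuclideanSpace.single a 1) := rfl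
    rw [h2, pderiv, this.fderiv]
    simp
  rw [h1, h1]
  have hs : IsSymmSndFDerivAt ℝ f y := hf.isSymmSndFDerivAt (by
    simpa [← one_add_one_eq_two] using one_add_one_le_infty)
  exact hs _ _

lemma IsLocalParam.differentiableAt_pderiv {E : Type*} [NormedAddCommGroup E]
    [InnerProductSpace ℝ E] {L : Set E} {k : ℕ} {φ : EuclideanSpace ℝ (Fin k) → E}
    {V : Set (EuclideanSpace ℝ (Fin k))} (h : IsLocalParam L k φ V)
    {y : EuclideanSpace ℝ (Fin k)} (hy : y ∈ V) (i : Fin k) : DifferentiableAt ℝ (pderiv φ i) y :=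
  ((contDiffOn_pderiv h.isOpen h.contDiffOn i).contDiffAt
    (h.isOpen.mem_nhds hy)).differentiableAt (by simp)

end Frames

/-! ### Harmonicity of functions with traceless affine gradient -/

section Laplacian

open Filter Topology Set Matrix

/-- The field `x ↦ B x + w`. -/
def affineField {m : ℕ} (B : Matrix (Fin m) (Fin m) ℂ) (w x : Cn m) : Cn m :=
  toEuclideanLin B x + w

/-- The function `u` has gradient `x ↦ B x + w`. -/
def HasAffineGradient {m : ℕ} (u : Cn m → ℝ) (B : Matrix (Fin m) (Fin m) ℂ) (w : Cn m) : Prop :=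
  ∀ x, HasFDerivAt u (innerSL ℝ (affineField B w x)) x

/-- Multiplication by a complex matrix as a real continuous linear map. -/
def realCLM {m : ℕ} (B : Matrix (Fin m) (Fin m) ℂ) : Cn m →L[ℝ] Cn m :=
  (LinearMap.toContinuousLinearMap (toEuclideanLin B)).restrictScalars ℝ

lemma realCLM_apply {m : ℕ} (B : Matrix (Fin m) (Fin m) ℂ) (x : Cn m) :
    realCLM B x = toEuclideanLin B x := rfl

lemma hasFDerivAt_affineField {m : ℕ} (B : Matrix (Fin m) (Fin m) ℂ) (w x : Cn m) :
    HasFDerivAt (affineField B w) (realCLM B) x :=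
  (realCLM B).hasFDerivAt.add_const w

lemma contDiff_affineField {m : ℕ} (B : Matrix (Fin m) (Fin m) ℂ) (w : Cn m) :
    ContDiff ℝ ∞ (affineField B w) :=
  (realCLM B).contDiff.add contDiff_const

lemma HasAffineGradient.contDiff {m : ℕ} {u : Cn m → ℝ} {B : Matrix (Fin m) (Fin m) ℂ} {w : Cn m}
    (h : HasAffineGradient u B w) : ContDiff ℝ ∞ u := by
  refine contDiff_infty_iff_fderiv.2 ⟨fun x => (h x).differentiableAt, ?_⟩
  have e : fderiv ℝ u = fun x => innerSL ℝ (affineField B w x) := funext fun x => (h x).fderiv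
  rw [e]
  exact (innerSL ℝ : Cn m →L[ℝ] Cn m →L[ℝ] ℝ).contDiff.comp (contDiff_affineField B w)

lemma eqOn_pullback {E : Type*} [NormedAddCommGroup E] [InnerProductSpace ℝ E] {L : Set E}
    {k : ℕ} {φ : EuclideanSpace ℝ (Fin k) → E} {V : Set (EuclideanSpace ℝ (Fin k))}
    (h : IsLocalParam L k φ V) (u : E → ℝ) :
    EqOn (pullback (fun x : L => u x) φ) (u ∘ φ) V := fun _ hz => pullback_apply (h.mem hz)

lemma ContDiff.isSmooth {E : Type*} [NormedAddCommGroup E] [InnerProductSpace ℝ E] {L : Set E}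
    {u : E → ℝ} (hu : ContDiff ℝ ∞ u) (k : ℕ) : IsSmooth L k fun x : L => u x := fun _ _ h =>
  (hu.comp_contDiffOn h.contDiffOn).congr (eqOn_pullback h u)

lemma IsLocalParam.pderiv_pullback {m k : ℕ} {L : Set (Cn m)} {φ : EuclideanSpace ℝ (Fin k) → Cn m}
    {V : Set (EuclideanSpace ℝ (Fin k))} (h : IsLocalParam L k φ V) {u : Cn m → ℝ}
    {B : Matrix (Fin m) (Fin m) ℂ} {w : Cn m} (hu : HasAffineGradient u B w)
    {z : EuclideanSpace ℝ (Fin k)} (hz : z ∈ V) (j : Fin k) :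
    pderiv (pullback (fun x : L => u x) φ) j z =
      inner ℝ (pderiv φ j z) (affineField B w (φ z)) := by
  have e : pullback (fun x : L => u x) φ =ᶠ[𝓝 z] u ∘ φ :=
    (eqOn_pullback h u).eventuallyEq_of_mem (h.isOpen.mem_nhds hz)
  have hd := (hu (φ z)).comp z (h.differentiableAt hz).hasFDerivAt
  rw [pderiv, e.fderiv_eq, hd.fderiv, ContinuousLinearMap.comp_apply, innerSL_apply_apply,
    real_inner_comm]
  rfl

lemma pderiv_affineField_comp {m k : ℕ} (B : Matrix (Fin m) (Fin m) ℂ) (w : Cn m)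
    {φ : EuclideanSpace ℝ (Fin k) → Cn m} {z : EuclideanSpace ℝ (Fin k)}
    (h : DifferentiableAt ℝ φ z) (i : Fin k) :
    pderiv (fun z => affineField B w (φ z)) i z = toEuclideanLin B (pderiv φ i z) := by
  have hd := (hasFDerivAt_affineField B w (φ z)).comp z h.hasFDerivAt
  change fderiv ℝ (affineField B w ∘ φ) z _ = _
  rw [hd.fderiv]
  rfl

/-- The flux of a function whose gradient along the frame is given by `b`, from Cramer's rule. -/
lemma gradFlux_eq_of_sum {m k : ℕ} {φ : EuclideanSpace ℝ (Fin k) → Cn m}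
    {f : EuclideanSpace ℝ (Fin k) → ℝ} {z : EuclideanSpace ℝ (Fin k)}
    (hdet : 0 < (metric φ z).det) {ε r : ℝ} (hε : ε * ε = 1) (hr : r = ε * volDensity φ z)
    {F : Fin k → ℝ} (hF : ∀ j, ∑ i, metric φ z j i * F i = r * pderiv f j z) (i : Fin k) :
    gradFlux φ f i z = ε * F i := by
  have hu : IsUnit (metric φ z).det := isUnit_iff_ne_zero.2 hdet.ne'
  have h1 : metric φ z *ᵥ F = r • fun j => pderiv f j z := funext fun j => hF j
  have h2 := congrArg (fun x => (metric φ z)⁻¹ *ᵥ x) h1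
  simp only [mulVec_mulVec, nonsing_inv_mul _ hu, one_mulVec, mulVec_smul] at h2
  rw [h2, Pi.smul_apply, smul_eq_mul, hr, ← mul_assoc, ← mul_assoc, hε, one_mul]
  rfl

/-- The Laplacian of a function whose flux consists of values of the volume form. -/
lemma chartLaplacian_of_flux {m k : ℕ} {φ : EuclideanSpace ℝ (Fin k) → Cn m}
    {f : EuclideanSpace ℝ (Fin k) → ℝ} {y : EuclideanSpace ℝ (Fin k)} {ε : ℝ}
    {U : Fin k → EuclideanSpace ℝ (Fin k) → Fin m → Cn m}
    (hflux : ∀ i, gradFlux φ f i =ᶠ[𝓝 y] fun z => ε * (holVolForm (U i z)).re)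
    (hU : ∀ i j, DifferentiableAt ℝ (fun z => U i z j) y) :
    chartLaplacian φ f y = -((volDensity φ y)⁻¹ * (ε * (∑ i, ∑ j,
      holVolForm (Function.update (U i y) j (pderiv (fun z => U i z j) i y))).re)) := by
  have hre : ∀ i, pderiv (gradFlux φ f i) i y =
      ε * (∑ j, holVolForm (Function.update (U i y) j (pderiv (fun z => U i z j) i y))).re := by
    intro i
    rw [← pderiv_holVolForm (hU i), pderiv, (hflux i).fderiv_eq, pderiv,
      show (fun z => ε * (holVolForm (U i z)).re) = ε • fun z => (holVolForm (U i z)).re from rfl,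
      fderiv_const_smul_field]
    rfl
  rw [chartLaplacian, Finset.sum_congr rfl fun i _ => hre i, ← Finset.mul_sum, ← Complex.re_sum]

/-- On a special Lagrangian, a function whose gradient is a traceless complex affine field is
harmonic. -/
lemma IsSpecialLagrangian.isHarmonic {m : ℕ} {L : Set (Cn m)} (hL : IsSpecialLagrangian L)
    {u : Cn m → ℝ} {B : Matrix (Fin m) (Fin m) ℂ} {w : Cn m} (hu : HasAffineGradient u B w)
    (hB : B.trace = 0) : IsHarmonic L m fun x : L => u x := by
  refine ⟨ContDiff.isSmooth hu.contDiff m, fun φ V h y hy => ?_⟩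
  have hcal : ∀ z ∈ V, IsCalibratedFrame fun i => pderiv φ i z := fun z hz =>
    hL.isCalibratedFrame_pderiv h hz
  obtain ⟨ε, hε, hsign⟩ := exists_sign (v := fun z i => pderiv φ i z) (y := y)
    (continuousAt_pi.2 fun i => (h.differentiableAt_pderiv hy i).continuousAt)
    (by filter_upwards [h.isOpen.mem_nhds hy] with z hz using hcal z hz)
  let W : EuclideanSpace ℝ (Fin m) → Cn m := fun z => affineField B w (φ z)
  let U : Fin m → EuclideanSpace ℝ (Fin m) → Fin m → Cn m := fun i z =>
    Function.update (fun j => pderiv φ j z) i (W z)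
  have hflux : ∀ i, gradFlux φ (pullback (fun x : L => u x) φ) i =ᶠ[𝓝 y]
      fun z => ε * (holVolForm (U i z)).re := by
    intro i
    filter_upwards [h.isOpen.mem_nhds hy, hsign] with z hz hsz
    refine gradFlux_eq_of_sum (F := fun i => (holVolForm (U i z)).re) (h.det_metric_pos hz) hε
      hsz (fun j => ?_) i
    rw [h.pderiv_pullback hu hz]
    exact (hcal z hz).sum_gram_mul _ j
  have hWd : DifferentiableAt ℝ W y :=
    ((hasFDerivAt_affineField B w _).comp y (h.differentiableAt hy).hasFDerivAt).differentiableAt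
  have hUe : ∀ i j, (fun z => U i z j) = if j = i then W else pderiv φ j := by
    intro i j
    split_ifs with hij
    · subst hij; funext z; simp [U]
    · funext z; simp [U, hij]
  have hUd : ∀ i j, DifferentiableAt ℝ (fun z => U i z j) y := by
    intro i j
    rw [hUe]
    split_ifs
    · exact hWd
    · exact h.differentiableAt_pderiv hy j
  -- The terms `j = i` differentiate `W` and add up to `trace B · Ω`; the terms `j ≠ i` contain
  -- second derivatives of `φ` and cancel in pairs.
  have hsum : ∑ i, ∑ j, holVolForm (Function.update (U i y) j (pderiv (fun z => U i z j) i y)) = 0 := by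
    have h1 := sum_sum_holVolForm_update_update (fun j => pderiv φ j y) (W y)
      (Function.injective_id (α := Fin m)) (H := fun i j => pderiv (pderiv φ j) i y)
      (fun i j => pderiv_comm (h.contDiffAt hy) i j)
    have h2 := sum_holVolForm_update (fun j => pderiv φ j y) (hcal y hy).ne_zero B
    rw [hB, zero_mul] at h2
    refine Eq.trans ?_ ((congrArg₂ (· + ·) h2 h1).trans (add_zero 0))
    rw [← Finset.sum_add_distrib]
    refine Finset.sum_congr rfl fun i _ => ?_
    have h3 : ∀ j, holVolForm (Function.update (U i y) j (pderiv (fun z => U i z j) i y)) =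
        (if j = i then holVolForm (Function.update (fun j => pderiv φ j y) i
          (toEuclideanLin B (pderiv φ i y))) else 0) +
        (if j = i then 0 else holVolForm (Function.update (Function.update (fun j => pderiv φ j y)
          (id i) (W y)) (id j) (pderiv (pderiv φ j) i y))) := by
      intro j
      rw [hUe]
      by_cases hij : j = i
      · subst hij
        simp only [if_true, add_zero]
        rw [pderiv_affineField_comp B w (h.differentiableAt hy)]
        simp [U]
      · simp [hij, U]
    rw [Finset.sum_congr rfl fun j _ => h3 j, Finset.sum_add_distrib, Finset.sum_ite_eq' Finset.univ i]
    simp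
  have : chartLaplacian φ (pullback (fun x : L => u x) φ) y = 0 := by
    rw [chartLaplacian_of_flux hflux hUd, hsum]
    simp
  rw [this, pullback_zero]
  rfl

end Laplacian

/-! ### The cone near its link and the Laplacian of the link -/

section Link

open Filter Topology Set Matrix

lemma IsSpecialLagrangian.mem_tangentSet_of_hasFDerivAt {m : ℕ} {L : Set (Cn m)}
    (hL : IsSpecialLagrangian L) {x : Cn m} (hx : x ∈ L) {F : Type*} [NormedAddCommGroup F]
    [NormedSpace ℝ F] {f : F → Cn m} {f' : F →L[ℝ] Cn m} {p : F} (hf : HasFDerivAt f f' p)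
    (hp : f p = x) (hfL : ∀ᶠ q in 𝓝 p, f q ∈ L) (w : F) : f' w ∈ tangentSet L m x := by
  obtain ⟨φ, V, hφ, ⟨y, hy, rfl⟩, -⟩ := hL x hx
  exact (hφ.mem_tangentSet_iff hy).2 (hφ.mem_range_fderiv hy hf hp hfL w)

lemma IsSpecialLagrangian.mem_tangentSet_of_hasDerivAt {m : ℕ} {L : Set (Cn m)}
    (hL : IsSpecialLagrangian L) {x : Cn m} (hx : x ∈ L) {c : ℝ → Cn m} {c' : Cn m} {t : ℝ}
    (hc : HasDerivAt c c' t) (ht : c t = x) (hcL : ∀ᶠ s in 𝓝 t, c s ∈ L) :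
    c' ∈ tangentSet L m x := by
  simpa using hL.mem_tangentSet_of_hasFDerivAt hx hc.hasFDerivAt ht hcL 1

lemma IsSLCone.smul_mem {m : ℕ} {C : Set (Cn m)} (hC : IsSLCone C) {x : Cn m} (hx : x ∈ C) {t : ℝ}
    (ht : 0 < t) : t • x ∈ C :=
  hC.cone t ht ▸ mem_image_of_mem (fun x => t • x) hx

lemma IsSLCone.smul_mem_diff {m : ℕ} {C : Set (Cn m)} (hC : IsSLCone C) {x : Cn m}
    (hx : x ∈ C \ {0}) {t : ℝ} (ht : 0 < t) : t • x ∈ C \ {0} :=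
  ⟨hC.smul_mem hx.1 ht, by simpa [ht.ne'] using hx.2⟩

/-- The position vector is tangent to a cone. -/
lemma IsSLCone.self_mem_tangentSet {m : ℕ} {C : Set (Cn m)} (hC : IsSLCone C) {x : Cn m}
    (hx : x ∈ C \ {0}) : x ∈ tangentSet (C \ {0}) m x := by
  have hc : HasDerivAt (fun t : ℝ => t • x) x 1 := by
    simpa using (hasDerivAt_id (1 : ℝ)).smul_const x
  refine hC.specialLagrangian.mem_tangentSet_of_hasDerivAt hx hc (one_smul ℝ x) ?_
  filter_upwards [lt_mem_nhds (zero_lt_one' ℝ)] with t ht using hC.smul_mem_diff hx ht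

lemma link_subset {m : ℕ} (C : Set (Cn m)) : link C ⊆ C \ {0} := fun x hx =>
  ⟨hx.1, fun h0 => by
    have := hx.2
    rw [mem_singleton_iff.1 h0] at this
    simp at this⟩

/-- The frame of the tangent space of a cone made of the position vector and a coordinate frame of
the link. -/
def coneFrame {n : ℕ} (ψ : EuclideanSpace ℝ (Fin n) → Cn (n + 1)) (z : EuclideanSpace ℝ (Fin n)) :
    Fin (n + 1) → Cn (n + 1) :=
  Fin.cons (ψ z) fun i => pderiv ψ i z

section

variable {n : ℕ} {C : Set (Cn (n + 1))} {ψ : EuclideanSpace ℝ (Fin n) → Cn (n + 1)}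
  {V : Set (EuclideanSpace ℝ (Fin n))} {z : EuclideanSpace ℝ (Fin n)}

lemma inner_self_of_link (h : IsLocalParam (link C) n ψ V) (hz : z ∈ V) :
    inner ℝ (ψ z) (ψ z) = 1 := by
  have := (h.mem hz).2
  rw [mem_sphere_zero_iff_norm] at this
  rw [real_inner_self_eq_norm_sq, this]
  norm_num

lemma inner_pderiv_of_link (h : IsLocalParam (link C) n ψ V) (hz : z ∈ V) (i : Fin n) :
    inner ℝ (ψ z) (pderiv ψ i z) = 0 := by
  have h1 := (h.differentiableAt hz).hasFDerivAt.inner ℝ (h.differentiableAt hz).hasFDerivAt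
  have h2 : (fun t => inner ℝ (ψ t) (ψ t)) =ᶠ[𝓝 z] fun _ => (1 : ℝ) := by
    filter_upwards [h.isOpen.mem_nhds hz] with t ht using inner_self_of_link h ht
  have h3 := h1.unique ((hasFDerivAt_const (1 : ℝ) z).congr_of_eventuallyEq h2)
  have h4 := DFunLike.congr_fun h3 (EuclideanSpace.single i 1)
  simp only [ContinuousLinearMap.comp_apply, ContinuousLinearMap.prod_apply,
    fderivInnerCLM_apply, _root_.zero_apply] at h4
  rw [real_inner_comm (ψ z)] at h4
  have h5 : inner ℝ (ψ z) (fderiv ℝ ψ z (EuclideanSpace.single i 1)) = 0 := by linarith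
  exact h5

lemma gram_coneFrame_zero_succ (h : IsLocalParam (link C) n ψ V) (hz : z ∈ V) (i : Fin n) :
    gram ℝ (coneFrame ψ z) 0 i.succ = 0 := inner_pderiv_of_link h hz i

lemma gram_coneFrame_succ_zero (h : IsLocalParam (link C) n ψ V) (hz : z ∈ V) (i : Fin n) :
    gram ℝ (coneFrame ψ z) i.succ 0 = 0 :=
  (real_inner_comm _ _).trans (inner_pderiv_of_link h hz i)

lemma gram_coneFrame_zero_zero (h : IsLocalParam (link C) n ψ V) (hz : z ∈ V) :
    gram ℝ (coneFrame ψ z) 0 0 = 1 := inner_self_of_link h hz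

/-- The position vector is a unit vector orthogonal to the link, so the Gram matrix is block
diagonal. The volume density of the link is thus `±Re Ω` of the cone frame. -/
lemma det_gram_coneFrame (h : IsLocalParam (link C) n ψ V) (hz : z ∈ V) :
    (gram ℝ (coneFrame ψ z)).det = (metric ψ z).det := by
  rw [det_succ_row_zero, Fin.sum_univ_succ]
  simp only [gram_coneFrame_zero_succ h hz, gram_coneFrame_zero_zero h hz]
  have : (gram ℝ (coneFrame ψ z)).submatrix Fin.succ Fin.succ = metric ψ z := rfl
  simp [this]

lemma IsSLCone.isCalibratedFrame_coneFrame (hC : IsSLCone C) (h : IsLocalParam (link C) n ψ V)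
    (hz : z ∈ V) : IsCalibratedFrame (coneFrame ψ z) := by
  have hx := link_subset C (h.mem hz)
  refine hC.specialLagrangian.isCalibratedFrame hx (linearIndependent_of_det_gram_ne_zero ?_) ?_
  · rw [det_gram_coneFrame h hz]
    exact (h.det_metric_pos hz).ne'
  · refine Fin.cases (hC.self_mem_tangentSet hx) fun i => ?_
    refine hC.specialLagrangian.mem_tangentSet_of_hasFDerivAt hx
      (h.differentiableAt hz).hasFDerivAt rfl ?_ _
    filter_upwards [h.isOpen.mem_nhds hz] with q hq using link_subset C (h.mem hq)

lemma IsLocalParam.differentiableAt_coneFrame (h : IsLocalParam (link C) n ψ V) (hz : z ∈ V)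
    (j : Fin (n + 1)) : DifferentiableAt ℝ (fun t => coneFrame ψ t j) z := by
  refine Fin.cases ?_ (fun i => ?_) j
  · exact h.differentiableAt hz
  · exact h.differentiableAt_pderiv hz i

/-- The Laplacian on the link of a function whose gradient is a traceless complex affine field. -/
lemma IsSLCone.chartLaplacian_link (hC : IsSLCone C) (h : IsLocalParam (link C) n ψ V)
    {u : Cn (n + 1) → ℝ} {B : Matrix (Fin (n + 1)) (Fin (n + 1)) ℂ} {w : Cn (n + 1)}
    (hu : HasAffineGradient u B w) (hB : B.trace = 0) {y : EuclideanSpace ℝ (Fin n)} (hy : y ∈ V) :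
    chartLaplacian ψ (pullback (fun x : link C => u x) ψ) y =
      n * inner ℝ (ψ y) (affineField B w (ψ y)) + inner ℝ (ψ y) (toEuclideanLin B (ψ y)) := by
  have hcal : ∀ z ∈ V, IsCalibratedFrame (coneFrame ψ z) := fun z hz =>
    hC.isCalibratedFrame_coneFrame h hz
  obtain ⟨ε, hε, hsign⟩ := exists_sign (v := coneFrame ψ) (y := y)
    (continuousAt_pi.2 fun i => (h.differentiableAt_coneFrame hy i).continuousAt)
    (by filter_upwards [h.isOpen.mem_nhds hy] with z hz using hcal z hz)
  have hsign' : ∀ᶠ z in 𝓝 y, (holVolForm (coneFrame ψ z)).re = ε * volDensity ψ z := by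
    filter_upwards [h.isOpen.mem_nhds hy, hsign] with z hz hsz
    rw [hsz, det_gram_coneFrame h hz, volDensity]
  let W : EuclideanSpace ℝ (Fin n) → Cn (n + 1) := fun z => affineField B w (ψ z)
  let U : Fin n → EuclideanSpace ℝ (Fin n) → Fin (n + 1) → Cn (n + 1) := fun i z =>
    Function.update (coneFrame ψ z) i.succ (W z)
  have hflux : ∀ i, gradFlux ψ (pullback (fun x : link C => u x) ψ) i =ᶠ[𝓝 y]
      fun z => ε * (holVolForm (U i z)).re := by
    intro i
    filter_upwards [h.isOpen.mem_nhds hy, hsign'] with z hz hsz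
    refine gradFlux_eq_of_sum (F := fun i => (holVolForm (U i z)).re) (h.det_metric_pos hz) hε
      hsz (fun j => ?_) i
    rw [h.pderiv_pullback hu hz]
    have := (hcal z hz).sum_gram_mul (W z) j.succ
    rw [Fin.sum_univ_succ, gram_coneFrame_succ_zero h hz, zero_mul, zero_add] at this
    exact this
  have hWd : DifferentiableAt ℝ W y :=
    ((hasFDerivAt_affineField B w _).comp y (h.differentiableAt hy).hasFDerivAt).differentiableAt
  have hUe : ∀ i j, (fun z => U i z j) = if j = i.succ then W else fun z => coneFrame ψ z j := by
    intro i j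
    split_ifs with hij
    · subst hij; funext z; simp [U]
    · funext z; simp [U, hij]
  have hUd : ∀ i j, DifferentiableAt ℝ (fun z => U i z j) y := by
    intro i j
    rw [hUe]
    split_ifs
    · exact hWd
    · exact h.differentiableAt_coneFrame hy j
  -- Two terms survive, unlike on the cone: the derivative of the position slot, once for each of
  -- the `n` directions, and the position term missing from the trace sum.
  have hsum : ∑ i, ∑ j, holVolForm (Function.update (U i y) j (pderiv (fun z => U i z j) i y)) =
      -(n * holVolForm (Function.update (coneFrame ψ y) 0 (W y)) +
        holVolForm (Function.update (coneFrame ψ y) 0 (toEuclideanLin B (ψ y)))) := by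
    have h1 := sum_sum_holVolForm_update_update (coneFrame ψ y) (W y)
      (Fin.succ_injective n) (H := fun i j => pderiv (pderiv ψ j) i y)
      (fun i j => pderiv_comm (h.contDiffAt hy) i j)
    have h2 := sum_holVolForm_update (coneFrame ψ y) (hcal y hy).ne_zero B
    rw [hB, zero_mul, Fin.sum_univ_succ] at h2
    have h2' : ∑ i : Fin n, holVolForm (Function.update (coneFrame ψ y) i.succ
        (toEuclideanLin B (pderiv ψ i y))) =
        -holVolForm (Function.update (coneFrame ψ y) 0 (toEuclideanLin B (ψ y))) :=
      eq_neg_of_add_eq_zero_right h2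
    -- Differentiating the position slot puts `∂_i ψ` there; exchanging it with `W` in slot `i + 1`
    -- restores the frame and costs a sign.
    have h0 : ∀ i : Fin n, holVolForm (Function.update (U i y) 0 (pderiv (fun z => U i z 0) i y)) =
        -holVolForm (Function.update (coneFrame ψ y) 0 (W y)) := by
      intro i
      rw [hUe, if_neg (Fin.succ_ne_zero i).symm]
      have e := holVolForm_update_update_swap (coneFrame ψ y) (Fin.succ_ne_zero i).symm (W y)
        (pderiv ψ i y)
      refine e.trans ?_
      congr 2
      rw [Function.update_eq_self_iff, Function.update_of_ne (Fin.succ_ne_zero i)]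
      rfl
    have h3 : ∀ i j : Fin n,
        holVolForm (Function.update (U i y) j.succ (pderiv (fun z => U i z j.succ) i y)) =
        (if j = i then holVolForm (Function.update (coneFrame ψ y) i.succ
          (toEuclideanLin B (pderiv ψ i y))) else 0) +
        (if j = i then 0 else holVolForm (Function.update (Function.update (coneFrame ψ y)
          i.succ (W y)) j.succ (pderiv (pderiv ψ j) i y))) := by
      intro i j
      rw [hUe]
      by_cases hij : j = i
      · subst hij
        simp only [if_true, add_zero]
        rw [pderiv_affineField_comp B w (h.differentiableAt hy)]
        simp [U]
      · rw [if_neg hij, if_neg hij, zero_add, if_neg fun e => hij (Fin.succ_injective n e)]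
        rfl
    have h4 : ∀ i : Fin n,
        ∑ j, holVolForm (Function.update (U i y) j (pderiv (fun z => U i z j) i y)) =
        -holVolForm (Function.update (coneFrame ψ y) 0 (W y)) +
        (holVolForm (Function.update (coneFrame ψ y) i.succ (toEuclideanLin B (pderiv ψ i y))) +
        ∑ j, (if j = i then 0 else holVolForm (Function.update (Function.update (coneFrame ψ y)
          i.succ (W y)) j.succ (pderiv (pderiv ψ j) i y)))) := by
      intro i
      rw [Fin.sum_univ_succ, h0, Finset.sum_congr rfl fun j _ => h3 i j, Finset.sum_add_distrib,
        Finset.sum_ite_eq' Finset.univ i]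
      simp
    rw [Finset.sum_congr rfl fun i _ => h4 i, Finset.sum_add_distrib, Finset.sum_add_distrib, h2',
      h1]
    simp
    ring
  -- Row 0 of the Gram matrix is `(1, 0, …, 0)`, so Cramer's rule in that row picks out the radial
  -- component.
  have hrad : ∀ X : Cn (n + 1), (holVolForm (Function.update (coneFrame ψ y) 0 X)).re =
      ε * volDensity ψ y * inner ℝ (ψ y) X := by
    intro X
    have := (hcal y hy).sum_gram_mul X 0
    rw [Fin.sum_univ_succ, gram_coneFrame_zero_zero h hy, one_mul, hsign'.self_of_nhds] at this
    simp only [gram_coneFrame_zero_succ h hy, zero_mul, Finset.sum_const_zero, add_zero] at this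
    exact this
  have hvol : volDensity ψ y ≠ 0 := (Real.sqrt_pos.2 (h.det_metric_pos hy)).ne'
  rw [chartLaplacian_of_flux hflux hUd, hsum, Complex.neg_re, Complex.add_re, ← Complex.ofReal_natCast,
    Complex.re_ofReal_mul, hrad, hrad]
  field_simp
  linear_combination (n * inner ℝ (ψ y) (affineField B w (ψ y)) +
    inner ℝ (ψ y) (toEuclideanLin B (ψ y))) * hε

end

end Link

/-! ### The Lagrangian condition and invariance under tangent flows -/

section Tangent

open Filter Topology Set Matrix

/-- A vector with real Hermitian products with a calibrated frame lies in its real span. -/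
lemma IsCalibratedFrame.exists_eq_sum {m : ℕ} {p : Fin m → Cn m} (h : IsCalibratedFrame p)
    {w : Cn m} (hw : ∀ i, (inner ℂ (p i) w).im = 0) : ∃ c : Fin m → ℝ, w = ∑ k, c k • p k := by
  set b : Fin m → ℝ := fun j => inner ℝ (p j) w with hb
  refine ⟨(gram ℝ p)⁻¹ *ᵥ b, ?_⟩
  set c := (gram ℝ p)⁻¹ *ᵥ b with hc
  have hSc : gram ℝ p *ᵥ c = b := by
    rw [hc, mulVec_mulVec, mul_nonsing_inv _ (isUnit_iff_ne_zero.2 h.2), one_mulVec]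
  -- With `c` from the real orthogonal projection, the real parts agree; the imaginary parts vanish
  -- on both sides. As `Ω(p) ≠ 0`, `p` is a complex basis and the difference is zero.
  have h1 : ∀ j, inner ℂ (p j) (w - ∑ k, c k • p k) = 0 := by
    intro j
    have h2 : inner ℂ (p j) w = (b j : ℂ) :=
      Complex.ext (re_inner_complex _ _) (by simpa using hw j)
    have h3 : inner ℂ (p j) (∑ k, c k • p k) = ((gram ℝ p *ᵥ c) j : ℂ) := by
      rw [inner_sum]
      simp only [mulVec, dotProduct, Complex.ofReal_sum, Complex.ofReal_mul]
      refine Finset.sum_congr rfl fun k _ => ?_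
      have h4 : inner ℂ (p j) (p k) = (gram ℝ p j k : ℂ) := congrFun (congrFun h.gram_eq j) k
      rw [← h4, ← Complex.coe_smul, inner_smul_right, mul_comm]
    rw [inner_sub_right, h2, h3, hSc, sub_self]
  have h5 : (colMatrix p)ᴴ *ᵥ (w - ∑ k, c k • p k).ofLp = 0 := by
    funext j
    have := h1 j
    rw [inner_complex_eq] at this
    exact this
  have h6 : IsUnit ((colMatrix p)ᴴ).det := by
    rw [det_conjTranspose, isUnit_iff_ne_zero]
    exact star_ne_zero.2 h.ne_zero
  have h7 := congrArg (fun x => ((colMatrix p)ᴴ)⁻¹ *ᵥ x) h5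
  simp only [mulVec_mulVec, nonsing_inv_mul _ h6, one_mulVec, mulVec_zero] at h7
  exact sub_eq_zero.1 ((WithLp.ofLp_eq_zero 2).1 h7)

lemma kahlerForm_eq_im {m : ℕ} (v w : Cn m) : kahlerForm v w = (inner ℂ v w).im := by
  rw [inner_complex_eq, Complex.im_sum, kahlerForm]
  refine Finset.sum_congr rfl fun j _ => ?_
  simp
  ring

lemma kahlerForm_eq_inner {m : ℕ} (v w : Cn m) : kahlerForm v w = inner ℝ (Complex.I • v) w := by
  rw [kahlerForm_eq_im, ← re_inner_complex, inner_smul_left]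
  simp

lemma im_inner_comm {m : ℕ} (v w : Cn m) : (inner ℂ v w).im = -(inner ℂ w v).im := by
  rw [← inner_conj_symm v w, Complex.conj_im]

/-- Special Lagrangians are Lagrangian. -/
lemma IsSpecialLagrangian.kahlerForm_eq_zero {m : ℕ} {L : Set (Cn m)}
    (hL : IsSpecialLagrangian L) {x a b : Cn m} (hx : x ∈ L) (ha : a ∈ tangentSet L m x)
    (hb : b ∈ tangentSet L m x) : kahlerForm a b = 0 := by
  obtain ⟨φ, V, h, ⟨y, hy, rfl⟩, -⟩ := hL x hx
  obtain ⟨s, rfl⟩ := (h.mem_tangentSet_iff hy).1 ha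
  obtain ⟨t, rfl⟩ := (h.mem_tangentSet_iff hy).1 hb
  have hcal := hL.isCalibratedFrame_pderiv h hy
  change kahlerForm (fderiv ℝ φ y s) (fderiv ℝ φ y t) = 0
  rw [kahlerForm_eq_im, fderiv_eq_sum_pderiv, fderiv_eq_sum_pderiv, sum_inner, Complex.im_sum]
  refine Finset.sum_eq_zero fun i _ => ?_
  rw [inner_sum, Complex.im_sum]
  refine Finset.sum_eq_zero fun j _ => ?_
  rw [← Complex.coe_smul, ← Complex.coe_smul, inner_smul_left, inner_smul_right,
    Complex.conj_ofReal, Complex.im_ofReal_mul, Complex.im_ofReal_mul, hcal.im_inner]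
  simp

/-- If a function with affine gradient `X` vanishes on a special Lagrangian then `-i X` is tangent. -/
lemma IsSpecialLagrangian.mem_tangentSet_of_vanish {m : ℕ} {L : Set (Cn m)}
    (hL : IsSpecialLagrangian L) {u : Cn m → ℝ} {B : Matrix (Fin m) (Fin m) ℂ} {w : Cn m}
    (hu : HasAffineGradient u B w) (h0 : ∀ x ∈ L, u x = 0) {x v : Cn m} (hx : x ∈ L)
    (hv : Complex.I • v = affineField B w x) : v ∈ tangentSet L m x := by
  obtain ⟨φ, V, h, ⟨y, hy, rfl⟩, -⟩ := hL x hx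
  have hcal := hL.isCalibratedFrame_pderiv h hy
  -- The derivative of `u` along the frame is zero, so `i v` is normal; equivalently `v` has real
  -- Hermitian products with the frame.
  have h1 : ∀ i, (inner ℂ (pderiv φ i y) v).im = 0 := by
    intro i
    have h2 := h.pderiv_pullback hu hy i
    have h3 : pullback (fun x : L => u x) φ =ᶠ[𝓝 y] fun _ => 0 := by
      filter_upwards [h.isOpen.mem_nhds hy] with z hz
      rw [pullback_apply (h.mem hz)]
      exact h0 _ (h.mem hz)
    rw [pderiv, h3.fderiv_eq] at h2
    rw [im_inner_comm, ← kahlerForm_eq_im, kahlerForm_eq_inner, hv, real_inner_comm, ← h2]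
    simp
  obtain ⟨c, hc⟩ := hcal.exists_eq_sum h1
  refine (h.mem_tangentSet_iff hy).2 ⟨WithLp.toLp 2 c, ?_⟩
  change fderiv ℝ φ y _ = _
  rw [fderiv_eq_sum_pderiv, hc]

/-- Integral curves of a tangent vector field stay in the cone as long as they avoid the vertex. -/
lemma IsSLCone.mem_of_integralCurve {m : ℕ} {C : Set (Cn m)} (hC : IsSLCone C) {X : Cn m → Cn m}
    {K : NNReal} (hX : ContDiff ℝ ∞ X) (hK : LipschitzWith K X)
    (htan : ∀ x ∈ C \ {0}, X x ∈ tangentSet (C \ {0}) m x) {c : ℝ → Cn m}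
    (hc : ∀ t, HasDerivAt c (X (c t)) t) (hne : ∀ t, c t ≠ 0) (h0 : c 0 ∈ C) (t : ℝ) : c t ∈ C := by
  have hcc : Continuous c := continuous_iff_continuousAt.2 fun t => (hc t).continuousAt
  -- The set of times spent in `C` is clopen in the connected line: closed since `C` is, open by
  -- local invariance away from the vertex.
  have hclosed : IsClosed (c ⁻¹' C) := hC.isClosed.preimage hcc
  have hopen : IsOpen (c ⁻¹' C) := by
    refine isOpen_iff_mem_nhds.2 fun t ht => ?_
    obtain ⟨φ, V, h, ⟨y, hy, hyt⟩, -⟩ := hC.specialLagrangian (c t) ⟨ht, hne t⟩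
    filter_upwards [h.eventually_mem_of_integralCurve hy hX hK htan hc hyt.symm] with s hs
    exact hs.1
  have := IsClopen.eq_univ ⟨hclosed, hopen⟩ ⟨0, h0⟩
  exact (this ▸ mem_univ t : t ∈ c ⁻¹' C)

end Tangent

/-! ### The singular vertex excludes tangent translations -/

section Singular

open Filter Topology Set Matrix

/-- Used to move a chart of the punctured cone around `v` to a chart of the full cone around 0,
which contradicts singularity of the vertex. -/
lemma IsLocalParam.sub_const {E : Type*} [NormedAddCommGroup E] [InnerProductSpace ℝ E]
    {C : Set E} {k : ℕ} {φ : EuclideanSpace ℝ (Fin k) → E} {V : Set (EuclideanSpace ℝ (Fin k))}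
    (h : IsLocalParam (C \ {0}) k φ V) {v : E} (hv : ∀ x, x + v ∈ C ↔ x ∈ C) :
    IsLocalParam C k (fun z => φ z - v) V where
  isOpen := h.isOpen
  contDiffOn := h.contDiffOn.sub contDiffOn_const
  injective_fderiv y hy := by
    rw [fderiv_sub_const]
    exact h.injective_fderiv y hy
  isEmbedding := (Homeomorph.subRight v).isEmbedding.comp h.isEmbedding
  image_open := by
    obtain ⟨U, hU, hUV⟩ := h.image_open
    refine ⟨(fun x => x + v) ⁻¹' (U \ {0}),
      (hU.sdiff isClosed_singleton).preimage (continuous_add_const v), ?_⟩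
    ext x
    constructor
    · rintro ⟨z, hz, rfl⟩
      have h1 : φ z ∈ (C \ {0}) ∩ U := hUV ▸ mem_image_of_mem φ hz
      refine ⟨(hv _).1 (by simpa using h1.1.1), ?_⟩
      simpa using And.intro h1.2 h1.1.2
    · rintro ⟨hx, hxU, hx0⟩
      have h1 : x + v ∈ φ '' V := hUV ▸ ⟨⟨(hv x).2 hx, hx0⟩, hxU⟩
      obtain ⟨z, hz, hzx⟩ := h1
      exact ⟨z, hz, by simp [hzx]⟩

/-- A special Lagrangian cone of dimension at least two is not contained in a line. -/
lemma IsSLCone.exists_notMem_line {m : ℕ} (hm : 2 ≤ m) {C : Set (Cn m)} (hC : IsSLCone C)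
    (v : Cn m) : ∃ x ∈ C, ∀ t : ℝ, x + t • v ≠ 0 := by
  by_contra! hcon
  obtain ⟨x, hx⟩ := hC.nonempty
  obtain ⟨φ, V, h, ⟨y, hy, rfl⟩, -⟩ := hC.specialLagrangian x hx
  -- `Q` is `|v|²` times the projection orthogonal to `v`. If it kills the cone, it kills all
  -- coordinate tangent vectors, so two independent ones would be multiples of `v`.
  let Q : Cn m →L[ℝ] Cn m :=
    inner ℝ v v • ContinuousLinearMap.id ℝ (Cn m) - (innerSL ℝ v).smulRight v
  have hQ : ∀ z, Q z = inner ℝ v v • z - inner ℝ v z • v := fun z => rfl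
  have hQφ : ∀ z ∈ V, Q (φ z) = 0 := by
    intro z hz
    obtain ⟨t, ht⟩ := hcon _ (h.mem hz).1
    rw [eq_neg_of_add_eq_zero_left ht, hQ, inner_neg_right, inner_smul_right]
    module
  have hQp : ∀ i, Q (pderiv φ i y) = 0 := by
    intro i
    have h1 := Q.hasFDerivAt.comp y (h.differentiableAt hy).hasFDerivAt
    have h2 : Q ∘ φ =ᶠ[𝓝 y] fun _ => 0 := by
      filter_upwards [h.isOpen.mem_nhds hy] with z hz using hQφ z hz
    have h3 := h1.unique ((hasFDerivAt_const (0 : Cn m) y).congr_of_eventuallyEq h2)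
    exact DFunLike.congr_fun h3 (EuclideanSpace.single i 1)
  have hv0 : v ≠ 0 := by
    rintro rfl
    obtain ⟨t, ht⟩ := hcon _ (h.mem hy).1
    exact (h.mem hy).2 (by simpa using ht)
  have hvv : inner ℝ v v ≠ 0 := inner_self_ne_zero.2 hv0
  have hp := h.linearIndependent hy
  let i0 : Fin m := ⟨0, by omega⟩
  let i1 : Fin m := ⟨1, by omega⟩
  have hpair : LinearIndependent ℝ ![pderiv φ i0 y, pderiv φ i1 y] := by
    have h1 := hp.comp ![i0, i1] (by
      intro a b hab
      fin_cases a <;> fin_cases b <;> simp [i0, i1] at hab ⊢)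
    convert! h1 using 1
    funext a
    fin_cases a <;> rfl
  have hcomb : inner ℝ v (pderiv φ i1 y) • pderiv φ i0 y +
      (-inner ℝ v (pderiv φ i0 y)) • pderiv φ i1 y = 0 := by
    have e0 : inner ℝ v v • pderiv φ i0 y = inner ℝ v (pderiv φ i0 y) • v := sub_eq_zero.1 (hQp i0)
    have e1 : inner ℝ v v • pderiv φ i1 y = inner ℝ v (pderiv φ i1 y) • v := sub_eq_zero.1 (hQp i1)
    have : inner ℝ v v • (inner ℝ v (pderiv φ i1 y) • pderiv φ i0 y +
      (-inner ℝ v (pderiv φ i0 y)) • pderiv φ i1 y) = 0 := by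
      rw [smul_add, smul_comm _ (inner ℝ v (pderiv φ i1 y)), smul_comm _ (-inner ℝ v _), e0, e1]
      module
    exact (smul_eq_zero.1 this).resolve_left hvv
  have h0 := (LinearIndependent.pair_iff.1 hpair _ _ hcomb).2
  have e0 := hQp i0
  rw [hQ, neg_eq_zero.1 h0, zero_smul, sub_zero] at e0
  exact hp.ne_zero i0 ((smul_eq_zero.1 e0).resolve_left hvv)

/-- A cone with a tangent parallel vector field is nonsingular. -/
lemma IsSLCone.eq_zero_of_forall_mem_tangentSet {m : ℕ} (hm : 2 ≤ m) {C : Set (Cn m)}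
    (hC : IsSLCone C) {v : Cn m} (hv : ∀ x ∈ C \ {0}, v ∈ tangentSet (C \ {0}) m x) : v = 0 := by
  by_contra hv0
  -- Lines in direction `v` are integral curves of the constant field, but the invariance holds only
  -- for those missing the vertex.
  have hoff : ∀ x ∈ C, (∀ t : ℝ, x + t • v ≠ 0) → ∀ t : ℝ, x + t • v ∈ C := by
    intro x hx hne t
    refine hC.mem_of_integralCurve (X := fun _ => v) (K := 0) contDiff_const (LipschitzWith.const v)
      hv (c := fun t => x + t • v) (fun t => ?_) hne (by simpa using hx) t
    simpa using ((hasDerivAt_id t).smul_const v).const_add x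
  obtain ⟨x₀, hx₀, hne₀⟩ := hC.exists_notMem_line hm v
  -- The line through the vertex is a limit of the lines through `s x₀` as `s → 0⁺`; these miss the
  -- vertex and lie in the closed set `C`.
  have hline : ∀ t : ℝ, t • v ∈ C := by
    intro t
    have h1 : Tendsto (fun s : ℝ => s • x₀ + t • v) (𝓝[>] 0) (𝓝 (t • v)) := by
      have : Tendsto (fun s : ℝ => s • x₀ + t • v) (𝓝 0) (𝓝 ((0 : ℝ) • x₀ + t • v)) :=
        ((continuous_id.smul continuous_const).add continuous_const).tendsto 0
      rw [zero_smul, zero_add] at this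
      exact this.mono_left nhdsWithin_le_nhds
    refine hC.isClosed.mem_of_tendsto h1 ?_
    filter_upwards [self_mem_nhdsWithin] with s hs
    have hs' : (0 : ℝ) < s := hs
    refine hoff _ (hC.smul_mem hx₀ hs') (fun r hr => hne₀ (s⁻¹ * r) ?_) t
    have : s⁻¹ • (s • x₀ + r • v) = x₀ + (s⁻¹ * r) • v := by
      rw [smul_add, smul_smul, smul_smul, inv_mul_cancel₀ hs'.ne', one_smul]
    rw [← this, hr, smul_zero]
  have htrans : ∀ x ∈ C, ∀ t : ℝ, x + t • v ∈ C := by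
    intro x hx t
    by_cases h : ∀ s : ℝ, x + s • v ≠ 0
    · exact hoff x hx h t
    · push Not at h
      obtain ⟨s, hs⟩ := h
      have : x + t • v = (t - s) • v := by
        rw [eq_neg_of_add_eq_zero_left hs]
        module
      rw [this]
      exact hline _
  have hvC : v ∈ C \ {0} := ⟨by simpa using hline 1, hv0⟩
  obtain ⟨φ, V, h, ⟨y, hy, hyv⟩, -⟩ := hC.specialLagrangian v hvC
  refine hC.singular ⟨fun z => φ z - v, V, h.sub_const fun x => ⟨fun hx => ?_, fun hx => ?_⟩,
    ⟨y, hy, by simp [hyv]⟩⟩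
  · simpa using htrans _ hx (-1)
  · simpa using htrans _ hx 1

lemma hasAffineGradient_inner {m : ℕ} (w : Cn m) :
    HasAffineGradient (fun x => inner ℝ w x) 0 w := by
  intro x
  have : affineField 0 w x = w := by simp [affineField]
  rw [this]
  exact (innerSL ℝ w).hasFDerivAt

lemma exists_inner_eq {m : ℕ} (l : Cn m →ₗ[ℝ] ℝ) : ∃ w : Cn m, ∀ x, l x = inner ℝ w x := by
  refine ⟨(InnerProductSpace.toDual ℝ (Cn m)).symm (LinearMap.toContinuousLinearMap l), fun x => ?_⟩
  rw [InnerProductSpace.toDual_symm_apply]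
  rfl

/-- A singular special Lagrangian cone spans `ℂᵐ` over the reals. -/
lemma IsSLCone.linear_eq_zero {m : ℕ} (hm : 2 ≤ m) {C : Set (Cn m)} (hC : IsSLCone C)
    (l : Cn m →ₗ[ℝ] ℝ) (hl : ∀ x ∈ C \ {0}, l x = 0) : l = 0 := by
  obtain ⟨w, hw⟩ := exists_inner_eq l
  -- The gradient is the constant `w`, and `-i w` is the vector whose product with `i` is `w`.
  have h0 : -(Complex.I • w) = 0 := by
    refine hC.eq_zero_of_forall_mem_tangentSet hm fun x hx => ?_
    refine hC.specialLagrangian.mem_tangentSet_of_vanish (hasAffineGradient_inner w)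
      (fun x hx => (hw x).symm.trans (hl x hx)) hx ?_
    simp [affineField, smul_smul]
  have hw0 : w = 0 := by simpa using h0
  ext x
  simp [hw, hw0]

end Singular

/-! ### The Lie algebra `su(m)`, its dimension, and exponentials -/

section MatrixGroups

open Filter Topology Set Matrix

/-- The Lie algebra of traceless skew-Hermitian matrices. -/
def suAlgebra (m : ℕ) : Submodule ℝ (Matrix (Fin m) (Fin m) ℂ) where
  carrier := {A | Aᴴ = -A ∧ A.trace = 0}
  zero_mem' := by simp
  add_mem' := by
    rintro A B ⟨hA, hA'⟩ ⟨hB, hB'⟩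
    exact ⟨by rw [conjTranspose_add, hA, hB, neg_add], by rw [trace_add, hA', hB', add_zero]⟩
  smul_mem' := by
    rintro c A ⟨hA, hA'⟩
    exact ⟨by rw [conjTranspose_smul, hA]; simp, by rw [trace_smul, hA', smul_zero]⟩

/-- Multiplication by `i` exchanges Hermitian and skew-Hermitian matrices, so each accounts for half
of the real dimension `2m²`. -/
lemma finrank_skewAdjoint (m : ℕ) :
    Module.finrank ℝ (skewAdjoint.submodule ℝ (Matrix (Fin m) (Fin m) ℂ)) = m ^ 2 := by
  have h1 : Module.finrank ℝ (Matrix (Fin m) (Fin m) ℂ) = 2 * m ^ 2 := by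
    rw [Module.finrank_matrix, Complex.finrank_real_complex]
    simp
    ring
  have h2 : Module.finrank ℝ (Matrix (Fin m) (Fin m) ℂ) =
      Module.finrank ℝ (selfAdjoint.submodule ℝ (Matrix (Fin m) (Fin m) ℂ)) +
        Module.finrank ℝ (skewAdjoint.submodule ℝ (Matrix (Fin m) (Fin m) ℂ)) := by
    rw [← Module.finrank_prod]
    exact (StarModule.decomposeProdAdjoint ℝ (Matrix (Fin m) (Fin m) ℂ)).finrank_eq
  let e : skewAdjoint.submodule ℝ (Matrix (Fin m) (Fin m) ℂ) ≃ₗ[ℝ]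
      selfAdjoint.submodule ℝ (Matrix (Fin m) (Fin m) ℂ) :=
    { toFun := fun A => ⟨Complex.I • (A : Matrix (Fin m) (Fin m) ℂ), by
        have h : star (A : Matrix (Fin m) (Fin m) ℂ) = -A := A.2
        change star (Complex.I • (A : Matrix (Fin m) (Fin m) ℂ)) =
          Complex.I • (A : Matrix (Fin m) (Fin m) ℂ)
        rw [star_smul, h]
        simp⟩
      invFun := fun A => ⟨-Complex.I • (A : Matrix (Fin m) (Fin m) ℂ), by
        have h : star (A : Matrix (Fin m) (Fin m) ℂ) = A := A.2
        change star (-Complex.I • (A : Matrix (Fin m) (Fin m) ℂ)) =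
          -(-Complex.I • (A : Matrix (Fin m) (Fin m) ℂ))
        rw [star_smul, h]
        simp⟩
      map_add' := fun A B => Subtype.ext (smul_add _ _ _)
      map_smul' := fun c A => Subtype.ext (smul_comm _ _ _)
      left_inv := fun A => Subtype.ext (by simp [smul_smul])
      right_inv := fun A => Subtype.ext (by simp [smul_smul]) }
  rw [← e.finrank_eq] at h2
  omega

/-- A skew-Hermitian matrix has imaginary trace, so tracelessness is one real condition, nontrivial
because of `i · 1`. -/
lemma finrank_suAlgebra {m : ℕ} (hm : 0 < m) : Module.finrank ℝ (suAlgebra m) = m ^ 2 - 1 := by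
  let f : skewAdjoint.submodule ℝ (Matrix (Fin m) (Fin m) ℂ) →ₗ[ℝ] ℝ :=
    (Complex.imLm ∘ₗ Matrix.traceLinearMap (Fin m) ℝ ℂ) ∘ₗ Submodule.subtype _
  have hf : ∀ A, f A = (trace (A : Matrix (Fin m) (Fin m) ℂ)).im := fun _ => rfl
  have hre : ∀ A : skewAdjoint.submodule ℝ (Matrix (Fin m) (Fin m) ℂ),
      (trace (A : Matrix (Fin m) (Fin m) ℂ)).re = 0 := by
    intro A
    have h : (A : Matrix (Fin m) (Fin m) ℂ)ᴴ = -A := A.2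
    have h1 := congrArg Complex.re (congrArg trace h)
    rw [trace_conjTranspose, trace_neg] at h1
    simp at h1
    linarith
  have hsurj : Function.Surjective f := by
    intro r
    refine ⟨⟨((r / m : ℝ) * Complex.I : ℂ) • (1 : Matrix (Fin m) (Fin m) ℂ), ?_⟩, ?_⟩
    · change star (_ • (1 : Matrix (Fin m) (Fin m) ℂ)) = -(_ • (1 : Matrix (Fin m) (Fin m) ℂ))
      rw [star_smul]
      simp
    · rw [hf]
      have : (m : ℝ) ≠ 0 := by positivity
      simp [trace_smul]
      field_simp
  have hker : suAlgebra m = (LinearMap.ker f).map (Submodule.subtype _) := by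
    ext A
    simp only [Submodule.mem_map, LinearMap.mem_ker, Submodule.subtype_apply]
    constructor
    · rintro ⟨h1, h2⟩
      exact ⟨⟨A, h1⟩, by rw [hf]; simp [h2], rfl⟩
    · rintro ⟨A, hA, rfl⟩
      exact ⟨A.2, Complex.ext (hre A) hA⟩
  have h1 := LinearMap.finrank_range_add_finrank_ker f
  rw [LinearMap.range_eq_top.2 hsurj, finrank_top, Module.finrank_self] at h1
  have h2 : Module.finrank ℝ (skewAdjoint.submodule ℝ (Matrix (Fin m) (Fin m) ℂ)) = m ^ 2 :=
    finrank_skewAdjoint m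
  rw [hker, Submodule.finrank_map_subtype_eq]
  omega

/-- Jacobi's formula at the identity. -/
lemma hasDerivAt_det_of_eq_one {m : ℕ} {γ : ℝ → Matrix (Fin m) (Fin m) ℂ}
    {A : Matrix (Fin m) (Fin m) ℂ} {t : ℝ} (h1 : γ t = 1)
    (hγ : ∀ i j, HasDerivAt (fun s => γ s i j) (A i j) t) :
    HasDerivAt (fun s => (γ s).det) A.trace t := by
  -- With the columns as a frame, the derivative of `det` at the identity is the sum computed in
  -- `sum_holVolForm_update`.
  let u : ℝ → Fin m → Cn m := fun s j => WithLp.toLp 2 fun i => γ s i j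
  have hu : ∀ j, HasDerivAt (fun s => u s j) (WithLp.toLp 2 fun i => A i j) t := fun j =>
    (PiLp.hasFDerivAt_toLp (𝕜 := ℝ) 2 _).comp_hasDerivAt t (hasDerivAt_pi.2 fun i => hγ i j)
  obtain ⟨D, hD, hDe⟩ := hasFDerivAt_holVolForm fun j => (hu j).hasFDerivAt
  have hdet : holVolForm (u t) = 1 := by
    have : colMatrix (u t) = 1 := by rw [← h1]; rfl
    rw [holVolForm_eq_det, this, det_one]
  have h2 := sum_holVolForm_update (u t) (by rw [hdet]; exact one_ne_zero) A
  rw [hdet, mul_one] at h2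
  have h3 := hD.hasDerivAt
  rw [hDe] at h3
  refine h3.congr_deriv (Eq.trans (Finset.sum_congr rfl fun j _ => ?_) h2)
  congr 2
  ext i
  simp [u, h1, toLpLin_apply, mulVec, dotProduct, one_apply]

/-- Differentiate `γ* γ = 1` and `det γ = 1` at 0. -/
lemma lieAlgebra_le_suAlgebra {m : ℕ} (G : Subgroup (specialUnitaryGroup (Fin m) ℂ)) :
    lieAlgebra G ≤ suAlgebra m := by
  rintro A ⟨γ, -, h0, -, hγ⟩
  have h0' : (γ 0 : Matrix (Fin m) (Fin m) ℂ) = 1 := by rw [h0]; rfl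
  constructor
  · ext i j
    have h1 : HasDerivAt (fun t => ∑ k, star ((γ t : Matrix (Fin m) (Fin m) ℂ) k i) *
        (γ t : Matrix (Fin m) (Fin m) ℂ) k j) (star (A j i) + A i j) 0 := by
      have := HasDerivAt.fun_sum (u := Finset.univ) fun k _ => ((hγ k i).star).mul (hγ k j)
      refine this.congr_deriv ?_
      simp [h0', one_apply, Finset.sum_add_distrib]
    have h2 : (fun t => ∑ k, star ((γ t : Matrix (Fin m) (Fin m) ℂ) k i) *
        (γ t : Matrix (Fin m) (Fin m) ℂ) k j) = fun _ => (1 : Matrix (Fin m) (Fin m) ℂ) i j := by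
      funext t
      have h3 : star (γ t : Matrix (Fin m) (Fin m) ℂ) * (γ t : Matrix (Fin m) (Fin m) ℂ) = 1 :=
        (mem_unitaryGroup_iff').1 (mem_specialUnitaryGroup_iff.1 (γ t).2).1
      rw [← h3]
      rfl
    rw [h2] at h1
    exact eq_neg_of_add_eq_zero_left (h1.unique (hasDerivAt_const _ _))
  · have h1 := hasDerivAt_det_of_eq_one h0' hγ
    have h2 : (fun t => (γ t : Matrix (Fin m) (Fin m) ℂ).det) = fun _ => 1 :=
      funext fun t => (mem_specialUnitaryGroup_iff.1 (γ t).2).2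
    rw [h2] at h1
    exact h1.unique (hasDerivAt_const _ _)

section Exp

open scoped Matrix.Norms.Operator

/-- The one-parameter group `t ↦ exp (t A)`. -/
def oneParam {m : ℕ} (A : Matrix (Fin m) (Fin m) ℂ) (t : ℝ) : Matrix (Fin m) (Fin m) ℂ :=
  NormedSpace.exp (t • A)

variable {m : ℕ} (A : Matrix (Fin m) (Fin m) ℂ)

lemma oneParam_zero : oneParam A 0 = 1 := by simp [oneParam]

lemma oneParam_add (s t : ℝ) : oneParam A (s + t) = oneParam A s * oneParam A t := by
  rw [oneParam, add_smul, Matrix.exp_add_of_commute]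
  · rfl
  · exact ((Commute.refl A).smul_left s).smul_right t

lemma hasDerivAt_linear_oneParam {F : Type*} [NormedAddCommGroup F] [NormedSpace ℝ F]
    (l : Matrix (Fin m) (Fin m) ℂ →ₗ[ℝ] F) (t : ℝ) :
    HasDerivAt (fun s => l (oneParam A s)) (l (A * oneParam A t)) t :=
  (LinearMap.toContinuousLinearMap l).hasFDerivAt.comp_hasDerivAt t
    (hasDerivAt_exp_smul_const' A t)

lemma contDiff_oneParam (i j : Fin m) : ContDiff ℝ ∞ fun t => oneParam A t i j := by
  have h1 : ContDiff ℝ ∞ (oneParam A) := by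
    refine contDiff_iff_contDiffAt.2 fun t => ?_
    exact ((NormedSpace.exp_analytic (𝕂 := ℝ) (t • A)).contDiffAt).comp t
      (contDiff_id.smul contDiff_const).contDiffAt
  exact (LinearMap.toContinuousLinearMap (entryLinearMap ℝ ℂ i j :
    Matrix (Fin m) (Fin m) ℂ →ₗ[ℝ] ℂ)).contDiff.comp h1

end Exp

variable {m : ℕ} {A : Matrix (Fin m) (Fin m) ℂ}

lemma hasDerivAt_oneParam_apply (A : Matrix (Fin m) (Fin m) ℂ) (i j : Fin m) (t : ℝ) :
    HasDerivAt (fun s => oneParam A s i j) ((A * oneParam A t) i j) t :=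
  hasDerivAt_linear_oneParam A (entryLinearMap ℝ ℂ i j) t

lemma hasDerivAt_oneParam_vec (A : Matrix (Fin m) (Fin m) ℂ) (x : Cn m) (t : ℝ) :
    HasDerivAt (fun s => toEuclideanLin (oneParam A s) x)
      (toEuclideanLin A (toEuclideanLin (oneParam A t) x)) t := by
  let l : Matrix (Fin m) (Fin m) ℂ →ₗ[ℝ] Cn m :=
    { toFun := fun M => toEuclideanLin M x
      map_add' := fun M N => by simp
      map_smul' := fun c M => by
        ext i
        simp [toLpLin_apply, smul_mulVec] }
  have h := hasDerivAt_linear_oneParam A l t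
  have e : l (A * oneParam A t) = toEuclideanLin A (toEuclideanLin (oneParam A t) x) := by
    simp [l, toLpLin_apply]
  rw [e] at h
  exact h

/-- The derivative of the determinant at 0 is the trace; the group law carries its vanishing to
every time. -/
lemma det_oneParam (hA : A.trace = 0) (t : ℝ) : (oneParam A t).det = 1 := by
  have h0 : HasDerivAt (fun s => (oneParam A s).det) 0 0 := by
    rw [← hA]
    refine hasDerivAt_det_of_eq_one (oneParam_zero A) fun i j => ?_
    simpa [oneParam_zero] using hasDerivAt_oneParam_apply A i j 0
  have h1 : ∀ t, HasDerivAt (fun s => (oneParam A s).det) 0 t := by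
    intro t
    have h2 : HasDerivAt (fun s => (oneParam A (s - t)).det) 0 t := by
      have h0' : HasDerivAt (fun s => (oneParam A s).det) 0 (t - t) := by rwa [sub_self]
      exact h0'.comp_sub_const t t
    have h3 := h2.const_mul (oneParam A t).det
    rw [mul_zero] at h3
    refine h3.congr_of_eventuallyEq (Eventually.of_forall fun s => ?_)
    simp only
    rw [← det_mul, ← oneParam_add]
    simp
  have h2 := is_const_of_deriv_eq_zero (fun t => (h1 t).differentiableAt) (fun t => (h1 t).deriv) t 0
  simpa [oneParam_zero] using h2

lemma oneParam_mem_specialUnitaryGroup (hA : A ∈ suAlgebra m) (t : ℝ) :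
    oneParam A t ∈ specialUnitaryGroup (Fin m) ℂ := by
  refine mem_specialUnitaryGroup_iff.2 ⟨mem_unitaryGroup_iff.2 ?_, det_oneParam hA.2 t⟩
  have h1 : star (oneParam A t) = oneParam A (-t) := by
    rw [star_eq_conjTranspose, oneParam, ← exp_conjTranspose, conjTranspose_smul, hA.1, oneParam]
    simp
  rw [h1, ← oneParam_add, add_neg_cancel, oneParam_zero]

lemma toEuclideanLin_oneParam_neg (A : Matrix (Fin m) (Fin m) ℂ) (t : ℝ) (x : Cn m) :
    toEuclideanLin (oneParam A (-t)) (toEuclideanLin (oneParam A t) x) = x := by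
  have h : oneParam A (-t) * oneParam A t = 1 := by
    rw [← oneParam_add, neg_add_cancel, oneParam_zero]
  simp [toLpLin_apply, h]

lemma oneParam_ne_zero (A : Matrix (Fin m) (Fin m) ℂ) (t : ℝ) {x : Cn m} (hx : x ≠ 0) :
    toEuclideanLin (oneParam A t) x ≠ 0 := fun h => hx <| by
  rw [← toEuclideanLin_oneParam_neg A t x, h, map_zero]

/-- A matrix of `su(m)` that is tangent to the cone generates symmetries of the cone. -/
lemma IsSLCone.mem_lieAlgebra {C : Set (Cn m)} (hC : IsSLCone C) (hA : A ∈ suAlgebra m)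
    (htan : ∀ x ∈ C \ {0}, toEuclideanLin A x ∈ tangentSet (C \ {0}) m x) :
    A ∈ lieAlgebra (stabilizerSU C) := by
  have hmem : ∀ t, ∀ x ∈ C, toEuclideanLin (oneParam A t) x ∈ C := by
    intro t x hx
    -- The vertex is fixed by linear maps; the flow argument covers only the other points.
    by_cases hx0 : x = 0
    · rw [hx0, map_zero, ← hx0]
      exact hx
    · refine hC.mem_of_integralCurve (realCLM A).contDiff (realCLM A).lipschitz htan
        (c := fun t => toEuclideanLin (oneParam A t) x) (hasDerivAt_oneParam_vec A x)
        (fun t => oneParam_ne_zero A t hx0) ?_ t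
      simpa [oneParam_zero, toLpLin_apply] using hx
  refine ⟨fun t => ⟨oneParam A t, oneParam_mem_specialUnitaryGroup hA t⟩, fun t => ?_,
    Subtype.ext (oneParam_zero A), contDiff_oneParam A, fun i j => ?_⟩
  · refine Subset.antisymm ?_ fun x hx => ?_
    · rintro _ ⟨x, hx, rfl⟩
      exact hmem t x hx
    · refine ⟨_, hmem (-t) x hx, ?_⟩
      have := toEuclideanLin_oneParam_neg A (-t) x
      rwa [neg_neg] at this
  · simpa [oneParam_zero] using hasDerivAt_oneParam_apply A i j 0

/-- Infinitesimal symmetries of the cone are tangent to it. -/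
lemma IsSLCone.mem_tangentSet_of_mem_lieAlgebra {C : Set (Cn m)} (hC : IsSLCone C)
    (hA : A ∈ lieAlgebra (stabilizerSU C)) {x : Cn m} (hx : x ∈ C \ {0}) :
    toEuclideanLin A x ∈ tangentSet (C \ {0}) m x := by
  obtain ⟨γ, hγ, h0, -, hd⟩ := hA
  have hc : HasDerivAt (fun t => toEuclideanLin (γ t : Matrix (Fin m) (Fin m) ℂ) x)
      (toEuclideanLin A x) 0 := by
    have h1 : HasDerivAt (fun t => (γ t : Matrix (Fin m) (Fin m) ℂ) *ᵥ x.ofLp) (A *ᵥ x.ofLp) 0 := by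
      refine hasDerivAt_pi.2 fun i => ?_
      simp only [mulVec, dotProduct]
      exact HasDerivAt.fun_sum fun j _ => (hd i j).mul_const (x j)
    exact (PiLp.hasFDerivAt_toLp (𝕜 := ℝ) 2 _).comp_hasDerivAt 0 h1
  have hc0 : toEuclideanLin (γ 0 : Matrix (Fin m) (Fin m) ℂ) x = x := by
    rw [h0]
    simp
  refine hC.specialLagrangian.mem_tangentSet_of_hasDerivAt hx hc hc0 ?_
  have hne : ∀ᶠ t in 𝓝 (0 : ℝ), toEuclideanLin (γ t : Matrix (Fin m) (Fin m) ℂ) x ≠ 0 :=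
    hc.continuousAt.eventually_ne (by rw [hc0]; exact hx.2)
  filter_upwards [hne] with t ht
  have h1 : toEuclideanLin (γ t : Matrix (Fin m) (Fin m) ℂ) '' C = C := hγ t
  exact ⟨h1 ▸ mem_image_of_mem _ hx.1, ht⟩

end MatrixGroups

/-! ### Moment maps and the kernel of their restriction to the cone -/

section MomentMaps

open Filter Topology Set Matrix

/-- The moment map of `x ↦ A x` that vanishes at the origin. -/
def momentQuad {m : ℕ} (A : Matrix (Fin m) (Fin m) ℂ) (x : Cn m) : ℝ :=
  kahlerForm (toEuclideanLin A x) x / 2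

lemma inner_toEuclideanLin_left {m : ℕ} (B : Matrix (Fin m) (Fin m) ℂ) (x y : Cn m) :
    inner ℂ (toEuclideanLin B x) y = inner ℂ x (toEuclideanLin Bᴴ y) := by
  rw [toEuclideanLin_conjTranspose_eq_adjoint, LinearMap.adjoint_inner_right]

lemma toEuclideanLin_smul_apply {m : ℕ} (c : ℂ) (A : Matrix (Fin m) (Fin m) ℂ) (x : Cn m) :
    toEuclideanLin (c • A) x = c • toEuclideanLin A x := by
  simp

lemma momentQuad_eq_inner {m : ℕ} (A : Matrix (Fin m) (Fin m) ℂ) (x : Cn m) :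
    momentQuad A x = inner ℝ (realCLM (Complex.I • A) x) x / 2 := by
  rw [momentQuad, kahlerForm_eq_inner, realCLM_apply, toEuclideanLin_smul_apply]

/-- `momentQuad A` is half the quadratic form of `iA`, which is Hermitian and hence symmetric for
the real inner product. -/
lemma hasAffineGradient_momentQuad {m : ℕ} {A : Matrix (Fin m) (Fin m) ℂ} (hA : Aᴴ = -A) :
    HasAffineGradient (momentQuad A) (Complex.I • A) 0 := by
  intro x
  have hB : (Complex.I • A)ᴴ = Complex.I • A := by
    rw [conjTranspose_smul, hA]
    simp
  have hsymm : ∀ h, inner ℝ (realCLM (Complex.I • A) h) x = inner ℝ (realCLM (Complex.I • A) x) h := by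
    intro h
    rw [real_inner_comm h, ← re_inner_complex, ← re_inner_complex, realCLM_apply, realCLM_apply,
      inner_toEuclideanLin_left, hB]
  have h1 := ((realCLM (Complex.I • A)).hasFDerivAt (x := x)).inner ℝ (hasFDerivAt_id x)
  have h2 := h1.mul_const (2⁻¹ : ℝ)
  have e : momentQuad A = fun y => inner ℝ (realCLM (Complex.I • A) y) (id y) * 2⁻¹ := by
    funext y
    rw [momentQuad_eq_inner, div_eq_mul_inv, id]
  rw [e]
  refine h2.congr_fderiv ?_
  ext1 h
  simp only [_root_.smul_apply, ContinuousLinearMap.comp_apply, ContinuousLinearMap.prod_apply,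
    fderivInnerCLM_apply, id, ContinuousLinearMap.id_apply, hsymm, innerSL_apply_apply, affineField,
    add_zero, smul_eq_mul]
  rw [← realCLM_apply]
  ring

lemma isMomentMap_momentQuad {m : ℕ} {A : Matrix (Fin m) (Fin m) ℂ} (hA : Aᴴ = -A) :
    IsMomentMap (fun x => toEuclideanLin A x) (momentQuad A) := by
  refine ⟨fun x => (hasAffineGradient_momentQuad hA x).differentiableAt, fun x w => ?_⟩
  rw [(hasAffineGradient_momentQuad hA x).fderiv, innerSL_apply_apply, affineField, add_zero,
    toEuclideanLin_smul_apply, kahlerForm_eq_inner]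

lemma momentQuad_smul_vec {m : ℕ} (A : Matrix (Fin m) (Fin m) ℂ) (t : ℝ) (x : Cn m) :
    momentQuad A (t • x) = t ^ 2 * momentQuad A x := by
  rw [momentQuad_eq_inner, momentQuad_eq_inner, map_smul, inner_smul_left, inner_smul_right]
  simp
  ring

lemma momentQuad_zero_vec {m : ℕ} (A : Matrix (Fin m) (Fin m) ℂ) : momentQuad A 0 = 0 := by
  simp [momentQuad_eq_inner]

/-- Two moment maps of one field differ by a constant, fixed by the value at 0. -/
lemma IsMomentMap.eq_momentQuad {m : ℕ} {A : Matrix (Fin m) (Fin m) ℂ} (hA : Aᴴ = -A)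
    {μ : Cn m → ℝ} (hμ : IsMomentMap (fun x => toEuclideanLin A x) μ) (h0 : μ 0 = 0) :
    μ = momentQuad A := by
  have hq := isMomentMap_momentQuad hA
  have hd : ∀ x, fderiv ℝ (μ - momentQuad A) x = 0 := by
    intro x
    rw [fderiv_sub (hμ.1 x) (hq.1 x), sub_eq_zero]
    ext1 w
    rw [hμ.2, hq.2]
  funext x
  have := is_const_of_fderiv_eq_zero (hμ.1.sub hq.1) hd x 0
  simp only [Pi.sub_apply, h0, momentQuad_zero_vec, sub_zero] at this
  exact sub_eq_zero.1 this

lemma isSuMomentMap_and_iff {m : ℕ} {μ : Cn m → ℝ} :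
    IsSuMomentMap μ ∧ μ 0 = 0 ↔ ∃ A ∈ suAlgebra m, μ = momentQuad A := by
  constructor
  · rintro ⟨⟨A, hA, htr, hμ⟩, h0⟩
    exact ⟨A, ⟨hA, htr⟩, hμ.eq_momentQuad hA h0⟩
  · rintro ⟨A, ⟨hA, htr⟩, rfl⟩
    exact ⟨⟨A, hA, htr, isMomentMap_momentQuad hA⟩, momentQuad_zero_vec A⟩

/-- Restriction to `L` of the moment maps of `su(m)`. -/
def momentRestrict {m : ℕ} (L : Set (Cn m)) : suAlgebra m →ₗ[ℝ] (L → ℝ) where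
  toFun A x := momentQuad A.1 x
  map_add' A B := by
    funext x
    simp only [momentQuad, kahlerForm_eq_inner, Submodule.coe_add, map_add, LinearMap.add_apply,
      smul_add, inner_add_left, Pi.add_apply]
    ring
  map_smul' c A := by
    funext x
    have h : toEuclideanLin (c • A.1) x.1 = c • toEuclideanLin A.1 x.1 := by
      rw [← Complex.coe_smul, ← Complex.coe_smul, toEuclideanLin_smul_apply]
    simp only [momentQuad, kahlerForm_eq_inner, Submodule.coe_smul, h, smul_comm Complex.I c,
      inner_smul_left, Pi.smul_apply, smul_eq_mul, RingHom.id_apply]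
    simp
    ring

/-- The moment maps of `su(m)` that vanish on the cone come from its infinitesimal symmetries. -/
lemma IsSLCone.map_ker_momentRestrict {m : ℕ} {C : Set (Cn m)} (hC : IsSLCone C) :
    (LinearMap.ker (momentRestrict (C \ {0}))).map (suAlgebra m).subtype =
      lieAlgebra (stabilizerSU C) := by
  ext A
  simp only [Submodule.mem_map, LinearMap.mem_ker, Submodule.subtype_apply]
  constructor
  · rintro ⟨A, hA, rfl⟩
    refine hC.mem_lieAlgebra A.2 fun x hx => ?_
    refine hC.specialLagrangian.mem_tangentSet_of_vanish (hasAffineGradient_momentQuad A.2.1)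
      (fun x hx => congrFun hA ⟨x, hx⟩) hx ?_
    rw [affineField, add_zero, toEuclideanLin_smul_apply]
  · intro hA
    refine ⟨⟨A, lieAlgebra_le_suAlgebra _ hA⟩, ?_, rfl⟩
    funext x
    -- Both `A x` and the position vector are tangent, and the cone is Lagrangian.
    have h := hC.specialLagrangian.kahlerForm_eq_zero x.2
      (hC.mem_tangentSet_of_mem_lieAlgebra hA x.2) (hC.self_mem_tangentSet x.2)
    change kahlerForm _ _ / 2 = 0
    rw [h, zero_div]

lemma IsSLCone.finrank_range_momentRestrict {m : ℕ} (hm : 0 < m) {C : Set (Cn m)}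
    (hC : IsSLCone C) :
    Module.finrank ℝ (LinearMap.range (momentRestrict (C \ {0}))) + lieDim (stabilizerSU C) =
      m ^ 2 - 1 := by
  rw [lieDim, ← hC.map_ker_momentRestrict, Submodule.finrank_map_subtype_eq,
    LinearMap.finrank_range_add_finrank_ker, finrank_suAlgebra hm]

end MomentMaps

/-! ### Eigenfunctions on the link and dimension counts -/

section Eigenfunctions

open Filter Topology Set Matrix

/-- `hlam` turns the formula for the link Laplacian into an eigenvalue equation: `n⟨x, w⟩ = n u` for
linear functions, `(n + 1)⟨x, Bx⟩ = 2(n + 1) u` for moment maps. -/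
lemma IsSLCone.mem_eigenspace_link {n : ℕ} {C : Set (Cn (n + 1))} (hC : IsSLCone C)
    {u : Cn (n + 1) → ℝ} {B : Matrix (Fin (n + 1)) (Fin (n + 1)) ℂ} {w : Cn (n + 1)}
    (hu : HasAffineGradient u B w) (hB : B.trace = 0) {lam : ℝ}
    (hlam : ∀ x, n * inner ℝ x (affineField B w x) + inner ℝ x (toEuclideanLin B x) = lam * u x) :
    (fun x : link C => u x) ∈ eigenspace (link C) n lam := by
  refine ⟨ContDiff.isSmooth hu.contDiff n, fun ψ V h y hy => ?_⟩
  rw [hC.chartLaplacian_link h hu hB hy, pullback_apply (h.mem hy), hlam]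
  rfl

lemma IsSLCone.inner_mem_eigenspace {n : ℕ} {C : Set (Cn (n + 1))} (hC : IsSLCone C)
    (w : Cn (n + 1)) : (fun x : link C => inner ℝ w x.1) ∈ eigenspace (link C) n n := by
  refine hC.mem_eigenspace_link (hasAffineGradient_inner w) (by simp) fun x => ?_
  simp [affineField, real_inner_comm]

lemma IsSLCone.momentQuad_mem_eigenspace {n : ℕ} {C : Set (Cn (n + 1))} (hC : IsSLCone C)
    {A : Matrix (Fin (n + 1)) (Fin (n + 1)) ℂ} (hA : A ∈ suAlgebra (n + 1)) :
    (fun x : link C => momentQuad A x.1) ∈ eigenspace (link C) n (2 * (n + 1)) := by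
  refine hC.mem_eigenspace_link (hasAffineGradient_momentQuad hA.1)
    (by rw [trace_smul, hA.2, smul_zero]) fun x => ?_
  rw [momentQuad_eq_inner, affineField, add_zero, realCLM_apply, real_inner_comm]
  ring

lemma mem_link_of_smul {m : ℕ} {C : Set (Cn m)} (hC : IsSLCone C) {x : Cn m} (hx : x ∈ C \ {0}) :
    ‖x‖⁻¹ • x ∈ link C := by
  have hx0 : x ≠ 0 := hx.2
  refine ⟨hC.smul_mem hx.1 (inv_pos.2 (norm_pos_iff.2 hx0)), ?_⟩
  rw [mem_sphere_zero_iff_norm, norm_smul, norm_inv, norm_norm,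
    inv_mul_cancel₀ (norm_ne_zero_iff.2 hx0)]

/-- Homogeneous functions on a cone are determined by their restrictions to the link. -/
lemma IsSLCone.rank_le_of_restrict_mem {m : ℕ} {C : Set (Cn m)} (hC : IsSLCone C) {α : ℝ}
    (W : Submodule ℝ (↥(C \ {0}) → ℝ)) (S : Submodule ℝ (link C → ℝ))
    (hhom : ∀ u ∈ W, IsHomogeneous α u)
    (hres : ∀ u ∈ W, (fun x : link C => u ⟨x, link_subset C x.2⟩) ∈ S) :
    Module.rank ℝ W ≤ Module.rank ℝ S := by
  let R : W →ₗ[ℝ] S :=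
    { toFun := fun u => ⟨fun x : link C => u.1 ⟨x, link_subset C x.2⟩, hres u.1 u.2⟩
      map_add' := fun _ _ => rfl
      map_smul' := fun _ _ => rfl }
  refine LinearMap.rank_le_of_injective R (LinearMap.ker_eq_bot.1 ?_)
  refine LinearMap.ker_eq_bot'.2 fun u hu => Subtype.ext (funext fun x => ?_)
  have hx0 : x.1 ≠ 0 := x.2.2
  have h1 := congrFun (congrArg Subtype.val hu) ⟨‖x.1‖⁻¹ • x.1, mem_link_of_smul hC x.2⟩
  have h2 := hhom u.1 u.2 ⟨‖x.1‖⁻¹ • x.1, link_subset C (mem_link_of_smul hC x.2)⟩ x ‖x.1‖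
    (norm_pos_iff.2 hx0) (by
      change x.1 = ‖x.1‖ • ‖x.1‖⁻¹ • x.1
      rw [smul_smul, mul_inv_cancel₀ (norm_ne_zero_iff.2 hx0), one_smul])
  rw [h2]
  exact (congrArg (_ * ·) h1).trans (mul_zero _)

/-- Restriction to `L` of the real linear functions. -/
def linearRestrict {m : ℕ} (L : Set (Cn m)) : (Cn m →ₗ[ℝ] ℝ) →ₗ[ℝ] (L → ℝ) where
  toFun l x := l x
  map_add' _ _ := rfl
  map_smul' _ _ := rfl

lemma IsSLCone.finrank_range_linearRestrict {m : ℕ} (hm : 2 ≤ m) {C : Set (Cn m)}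
    (hC : IsSLCone C) : Module.finrank ℝ (LinearMap.range (linearRestrict (C \ {0}))) = 2 * m := by
  have hinj : Function.Injective (linearRestrict (C \ {0})) := by
    refine LinearMap.ker_eq_bot.1 (LinearMap.ker_eq_bot'.2 fun l hl => ?_)
    exact hC.linear_eq_zero hm l fun x hx => congrFun hl ⟨x, hx⟩
  rw [LinearMap.finrank_range_of_inj hinj, Module.finrank_linearMap, Module.finrank_self, mul_one,
    ← Module.finrank_mul_finrank ℝ ℂ (Cn m), Complex.finrank_real_complex, finrank_euclideanSpace,
    Fintype.card_fin]

end Eigenfunctions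

end SLCone

end

open SLCone in
theorem proposition3p5 (m : ℕ) (hm : 2 < m) (C : Set (SLCone.Cn m)) (hC : SLCone.IsSLCone C) :
    -- order 1: restrictions of real linear functions
    ((∃ W : Submodule ℝ (↥(C \ {0}) → ℝ),
        (W : Set (↥(C \ {0}) → ℝ)) =
          {u | ∃ l : SLCone.Cn m →ₗ[ℝ] ℝ, u = fun x : ↥(C \ {0}) => l x} ∧
        (∀ u ∈ W, SLCone.IsHarmonic (C \ {0}) m u ∧ SLCone.IsHomogeneous 1 u) ∧
        Module.Finite ℝ W ∧ Module.finrank ℝ W = 2 * m) ∧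
      ((2 * m : ℕ) : Cardinal) ≤ SLCone.multiplicity C 1) ∧
    -- order 2: restrictions of su(m) moment maps vanishing at the origin
    ((∃ W : Submodule ℝ (↥(C \ {0}) → ℝ),
        (W : Set (↥(C \ {0}) → ℝ)) =
          {u | ∃ μ : SLCone.Cn m → ℝ, SLCone.IsSuMomentMap μ ∧ μ 0 = 0 ∧ u = fun x : ↥(C \ {0}) => μ x} ∧
        (∀ u ∈ W, SLCone.IsHarmonic (C \ {0}) m u ∧ SLCone.IsHomogeneous 2 u) ∧
        Module.Finite ℝ W ∧
        (Module.finrank ℝ W : ℤ) = (m : ℤ) ^ 2 - 1 - SLCone.lieDim (SLCone.stabilizerSU C)) ∧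
      ((m ^ 2 - 1 - SLCone.lieDim (SLCone.stabilizerSU C) : ℕ) : Cardinal) ≤
        SLCone.multiplicity C 2) := by
  -- `n` is the dimension of the link, and the cone frame is indexed by `Fin (n + 1)`.
  obtain ⟨n, rfl⟩ : ∃ n, m = n + 1 := ⟨m - 1, by omega⟩
  have hlinhom : ∀ u ∈ LinearMap.range (linearRestrict (C \ {0})), IsHomogeneous 1 u := by
    rintro _ ⟨l, rfl⟩ x y t - hxy
    change l y.1 = t ^ (1 : ℝ) * l x.1
    rw [hxy, map_smul, Real.rpow_one, smul_eq_mul]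
  have hquadhom : ∀ u ∈ LinearMap.range (momentRestrict (C \ {0})), IsHomogeneous 2 u := by
    rintro _ ⟨A, rfl⟩ x y t - hxy
    change momentQuad A.1 y.1 = t ^ (2 : ℝ) * momentQuad A.1 x.1
    rw [hxy, momentQuad_smul_vec, Real.rpow_two]
  have hlin := hC.finrank_range_linearRestrict (by omega)
  have hquad := hC.finrank_range_momentRestrict (by omega)
  refine ⟨⟨⟨LinearMap.range (linearRestrict (C \ {0})), ?_, ?_, inferInstance, hlin⟩, ?_⟩,
    ⟨⟨LinearMap.range (momentRestrict (C \ {0})), ?_, ?_, inferInstance, ?_⟩, ?_⟩⟩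
  · ext u
    exact exists_congr fun l => eq_comm
  · intro u hu
    refine ⟨?_, hlinhom u hu⟩
    obtain ⟨l, rfl⟩ := hu
    obtain ⟨w, hw⟩ := exists_inner_eq l
    have e : linearRestrict (C \ {0}) l = fun x : ↥(C \ {0}) => inner ℝ w x.1 :=
      funext fun x => hw x
    rw [e]
    exact hC.specialLagrangian.isHarmonic (hasAffineGradient_inner w) (Matrix.trace_zero _ _)
  · rw [← hlin, Module.finrank_eq_rank, SLCone.multiplicity]
    refine hC.rank_le_of_restrict_mem _ _ hlinhom ?_
    rintro _ ⟨l, rfl⟩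
    obtain ⟨w, hw⟩ := exists_inner_eq l
    have e : (fun x : link C => linearRestrict (C \ {0}) l ⟨x, link_subset C x.2⟩) =
        fun x : link C => inner ℝ w x.1 := funext fun x => hw x
    rw [e, show (1 : ℝ) * (1 + ((n + 1 : ℕ) : ℝ) - 2) = n by push_cast; ring]
    exact hC.inner_mem_eigenspace w
  · ext u
    constructor
    · rintro ⟨A, rfl⟩
      obtain ⟨h1, h2⟩ := isSuMomentMap_and_iff.2 ⟨A.1, A.2, rfl⟩
      exact ⟨_, h1, h2, rfl⟩
    · rintro ⟨μ, h1, h2, rfl⟩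
      obtain ⟨A, hA, rfl⟩ := isSuMomentMap_and_iff.1 ⟨h1, h2⟩
      exact ⟨⟨A, hA⟩, rfl⟩
  · intro u hu
    refine ⟨?_, hquadhom u hu⟩
    obtain ⟨A, rfl⟩ := hu
    exact hC.specialLagrangian.isHarmonic (hasAffineGradient_momentQuad A.2.1)
      (by rw [Matrix.trace_smul, A.2.2, smul_zero])
  · have h1 : 1 ≤ (n + 1) ^ 2 := Nat.one_le_pow _ _ (by omega)
    zify [h1] at hquad
    push_cast at hquad ⊢
    linarith
  -- The natural-number subtraction is not truncated: `hquad` writes `m² - 1` as the rank plus `dim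
  -- G`.
  · rw [← hquad, Nat.add_sub_cancel, Module.finrank_eq_rank, SLCone.multiplicity]
    refine hC.rank_le_of_restrict_mem _ _ hquadhom ?_
    rintro _ ⟨A, rfl⟩
    rw [show (2 : ℝ) * (2 + ((n + 1 : ℕ) : ℝ) - 2) = 2 * (n + 1) by push_cast; ring]
    exact hC.momentQuad_mem_eigenspace A.2
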